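/- Let $\boldsymbol{T}=(\mathbb{R}\cup\{-\infty\},\oplus=\max,\odot=+)$ be the tropical semifield, let $n\ge 0$, and let $\boldsymbol{T}[X_1^{\pm},\dots,X_n^{\pm}]$ be the semiring of (formal) tropical Laurent polynomials $f=\bigoplus_{\boldsymbol m} c_{\boldsymbol m}\odot \boldsymbol X^{\odot \boldsymbol m}$ (finitely many $\boldsymbol m\in\mathbb{Z}^n$ with $c_{\boldsymbol m}\neq-\infty$), with values $f(x)=\max_{\boldsymbol m}(c_{\boldsymbol m}+\langle \boldsymbol m,x\rangle)$ for $x\in\mathbb{R}^n$. A congruence on a commutative semiring $S$ is an equivalence relation $E\subset S\times S$ compatible with addition and multiplication; it is proper if $E\ne S\times S$, and prime if it is proper and $(ac+bd,\,ad+bc)\in E$ implies $(a,b)\in E$ or $(c,d)\in E$. The Krull dimension $\dim A$ of an additively idempotent commutative semiring $A$ is the maximum length $k$ of chains $E_0\subsetneq E_1\subsetneq\cdots\subsetneq E_k$ of prime congruences on $A$. For $S\subset \boldsymbol{T}[X_1^{\pm},\dots,X_n^{\pm}]^2$ put $\boldsymbol V(S)=\{x\in\mathbb{R}^n \mid f(x)=g(x)\text{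 for all }(f,g)\in S\}$. A finite congruence tropical basis of a congruence $C$ is a finite subset $S\subset C$ with $\boldsymbol V(S)=\boldsymbol V(C)$. For a tropical Laurent polynomial $f$ let $f_{\boldsymbol B}$ be obtained from $f$ by replacing every coefficient other than $-\infty$ by the real number $0$, and let $C_{\boldsymbol B}$ be the congruence generated by $\{(f_{\boldsymbol B},g_{\boldsymbol B})\mid (f,g)\in C\}$. The dimension of a nonempty polyhedral set $\{x\in\mathbb{R}^n\mid Ax\ge b\}$ is the dimension of its affine hull, and the empty set has dimension $-\infty$. A (finite) polyhedral complex has as dimension the maximum of the dimensions of its cells, and if a subset $X\subset\mathbb{R}^n$ is the support (union of the cells) of some polyhedral complex, $\dim X$ denotes the dimension of any polyhedral complex with support $X$ (it does not depend on the choice). **Theorem.** Let $C$ be a proper congruence on $\boldsymbol{T}[X_1^{\pm},\dots,X_n^{\pm}]$ such that both $C$ and $C_{\boldsymbol B}$ have finite congruence tropical bases. Then $\boldsymbol V(C)$ and $\boldsymbol V(C_{\boldsymbol B})$ are supports of polyhedral complexes, so that their dimensions are well defined, and $$\dim \boldsymbol{T}[X_1^{\pm},\dots,X_n^{\pm}]/C=\max\{\dim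 \boldsymbol V(C)+1,\ \dim \boldsymbol V(C_{\boldsymbol B})\},$$ where $-\infty+1=-\infty$. -/

import Mathlib

noncomputable section

namespace TropKrull

open Matrix

/-! ### Polyhedral geometry in `ℝⁿ` -/

/-- A polyhedral set in `ℝⁿ`: the solution set `{x | A x ≥ b}` of finitely many (affine) linear
inequalities. The empty set is allowed. -/
def IsPolyhedralSet {n : ℕ} (P : Set (Fin n → ℝ)) : Prop :=
  ∃ (l : ℕ) (A : Matrix (Fin l) (Fin n) ℝ) (b : Fin l → ℝ), P = {x | b ≤ A *ᵥ x}

/-- `F` is a (nonempty) face of `P`: the nonempty locus where some linear functional attains its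
minimum on `P`. The zero functional shows that a nonempty `P` is a face of itself. -/
def IsFace {n : ℕ} (F P : Set (Fin n → ℝ)) : Prop :=
  F.Nonempty ∧ ∃ w : Fin n → ℝ, F = {x | x ∈ P ∧ ∀ y ∈ P, w ⬝ᵥ x ≤ w ⬝ᵥ y}

open Classical in
/-- The dimension of a polyhedral set: the dimension of its affine hull, and `-∞` (that is, `⊥`)
for the empty set. -/
def polyhedralSetDim {n : ℕ} (P : Set (Fin n → ℝ)) : WithBot ℕ∞ :=
  if P.Nonempty then ((Module.finrank ℝ (affineSpan ℝ P).direction : ℕ) : WithBot ℕ∞) else ⊥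

/-- A polyhedral complex in `ℝⁿ`: finitely many polyhedral sets, closed under passing to (nonempty)
faces, any two of which are disjoint or meet in a common face. -/
structure PolyhedralComplex (n : ℕ) where
  cells : Set (Set (Fin n → ℝ))
  finite_cells : cells.Finite
  polyhedral : ∀ P ∈ cells, IsPolyhedralSet P
  face_mem : ∀ P ∈ cells, ∀ F, IsFace F P → F ∈ cells
  inter_face : ∀ P ∈ cells, ∀ Q ∈ cells,
    (P ∩ Q).Nonempty → IsFace (P ∩ Q) P ∧ IsFace (P ∩ Q) Q

/-- The support of a polyhedral complex: the union of its cells. -/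
def PolyhedralComplex.support {n : ℕ} (K : PolyhedralComplex n) : Set (Fin n → ℝ) :=
  ⋃₀ K.cells

/-- The dimension of a polyhedral complex: the maximum of the dimensions of its cells (`⊥` if there
is no nonempty cell). -/
def PolyhedralComplex.dim {n : ℕ} (K : PolyhedralComplex n) : WithBot ℕ∞ :=
  ⨆ P ∈ K.cells, polyhedralSetDim P

/-- The set `X` is the support of a polyhedral complex, and `d` is its dimension, i.e. the common
dimension of all polyhedral complexes with support `X`. -/
def HasPolyhedralDim {n : ℕ} (X : Set (Fin n → ℝ)) (d : WithBot ℕ∞) : Prop :=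
  (∃ K : PolyhedralComplex n, K.support = X) ∧
    ∀ K : PolyhedralComplex n, K.support = X → K.dim = d

/-! ### Prime congruences and Krull dimension -/

/-- A prime congruence: a proper congruence `E` such that `α ⋊ β ∈ E` implies `α ∈ E` or `β ∈ E`,
where `(a, b) ⋊ (c, d) = (a c + b d, a d + b c)`. -/
def IsPrimeCong {A : Type*} [CommSemiring A] (E : RingCon A) : Prop :=
  E ≠ ⊤ ∧ ∀ a b c d : A, E (a * c + b * d) (a * d + b * c) → E a b ∨ E c d

/-- The Krull dimension of an (additively idempotent) semiring: the supremum of the lengths `k` of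
the chains `E₀ ⊊ E₁ ⊊ ⋯ ⊊ E_k` of prime congruences (`⊥` if there are none, `⊤` if unbounded). -/
def congKrullDim (A : Type*) [CommSemiring A] : WithBot ℕ∞ :=
  Order.krullDim {E : RingCon A // IsPrimeCong E}

/-! ### Tropical Laurent polynomials -/

/-- The (max-plus) tropical semifield `(ℝ ∪ {-∞}, max, +)`. Mathlib's `Tropical` is min-plus; over
the order dual of `ℝ` the minimum is the usual maximum, and the adjoined top element is `-∞`. -/
abbrev T : Type := Tropical (WithTop ℝᵒᵈ)

/-- The real number `r` as an element of the tropical semifield. -/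
def ofReal (r : ℝ) : T := Tropical.trop ((OrderDual.toDual r : ℝᵒᵈ) : WithTop ℝᵒᵈ)

/-- The tropical Laurent polynomial semiring `T[X₁^±, …, Xₙ^±]`: finite formal tropical sums of
terms `c ⊙ X^m` with exponent vectors `m ∈ ℤⁿ`. -/
abbrev Laurent (n : ℕ) : Type := AddMonoidAlgebra T (Fin n → ℤ)

/-- The value `f(x) = max_m (c_m + ⟨m, x⟩)` of a tropical Laurent polynomial `f = ⨁ c_m ⊙ X^m` at
`x ∈ ℝⁿ`; the sum, the product and the empty sum (`-∞`) are those of the tropical semifield. -/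
def eval {n : ℕ} (f : Laurent n) (x : Fin n → ℝ) : T :=
  ∑ m ∈ f.coeff.support, f.coeff m * ofReal (∑ i, (m i : ℝ) * x i)

/-- The congruence variety `V(S) = {x ∈ ℝⁿ | f(x) = g(x) for all (f, g) ∈ S}`. -/
def congVariety {n : ℕ} (S : Set (Laurent n × Laurent n)) : Set (Fin n → ℝ) :=
  {x | ∀ p ∈ S, eval p.1 x = eval p.2 x}

/-- A congruence as a set of pairs. -/
def pairs {n : ℕ} (C : RingCon (Laurent n)) : Set (Laurent n × Laurent n) :=
  {p | C p.1 p.2}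

/-- `C` has a finite congruence tropical basis: a finite subset of `C` with the same congruence
variety as `C`. -/
def HasFiniteTropicalBasis {n : ℕ} (C : RingCon (Laurent n)) : Prop :=
  ∃ S : Set (Laurent n × Laurent n), S.Finite ∧ S ⊆ pairs C ∧
    congVariety (pairs C) = congVariety S

/-- `f_B`: every coefficient of `f` other than `-∞` is replaced by the real number `0`, which is the
unit `1` of the tropical semifield. -/
def boolPart {n : ℕ} (f : Laurent n) : Laurent n :=
  ∑ m ∈ f.coeff.support, AddMonoidAlgebra.single m (1 : T)

/-- `C_B`: the congruence generated by the pairs `(f_B, g_B)` with `(f, g) ∈ C`. -/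
def boolCong {n : ℕ} (C : RingCon (Laurent n)) : RingCon (Laurent n) :=
  ringConGen fun p q => ∃ f g : Laurent n, C f g ∧ p = boolPart f ∧ q = boolPart g

end TropKrull

end

/-! A `TotalCone` is the nonnegative part of a total group preorder on the terms r ⊙ X^m, i.e. on ℝ
× ℤⁿ, extending the order of ℝ. Identifying polynomials that dominate each other gives a prime
congruence, and each prime congruence comes from exactly one cone (`isPrimeCong_cong`, `cong_cone`,
`cong_le_cong_iff`). So the Krull dimension is the maximal length of chains of cones N with C ≤
`N.cong` (`congKrullDim_quotient`).

Upper bound: the rank of the lattice `dir` of exponents equivalent to constants, plus one if all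
constants are equivalent, grows strictly along a chain and is at most n + 1. It remains to see that
the smallest cone N forces a variety of dimension at least n − rank. If N separates constants,
Fourier–Motzkin elimination yields a real point with the signs of N on the finitely many term
differences of a tropical basis, and small moves orthogonal to `dir` stay in V(C)
(`containsBall_congVariety`). If N identifies all constants, it sees only exponents, and the
argument is applied to C_B.

Lower bound: a k-dimensional ball around x in V(C) gives lexicographic preorders that compare at x
and then along k independent directions. On finitely many terms they look like nearby points, so
they lie above C; with the trivial preorder they form a chain of length k + 1. For C_B only
exponents are compared, so the point itself serves as the first direction and the length is k.

Dimension enters only through `ContainsBall`, which depends on the support and not on the complex.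
-/

noncomputable section

namespace TropKrull

open Matrix

variable {n : ℕ}

/-! ### Arithmetic of tropical numbers -/

theorem ofReal_ne_zero (r : ℝ) : ofReal r ≠ 0 :=
  fun h => WithTop.coe_ne_top (congrArg Tropical.untrop h)

theorem ofReal_injective : Function.Injective ofReal := fun _ _ h =>
  OrderDual.toDual.injective (WithTop.coe_injective (Tropical.trop_injective h))

theorem eq_zero_or_eq_ofReal (c : T) : c = 0 ∨ ∃ r, c = ofReal r := by
  induction c using Tropical.tropRec with
  | h c =>
    induction c using WithTop.recTopCoe with
    | top => exact Or.inl rfl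
    | coe r => exact Or.inr ⟨OrderDual.ofDual r, rfl⟩

theorem ofReal_mul_ofReal (r s : ℝ) : ofReal r * ofReal s = ofReal (r + s) := rfl

theorem ofReal_zero : ofReal 0 = 1 := rfl

theorem ofReal_le_ofReal {r s : ℝ} : ofReal r ≤ ofReal s ↔ s ≤ r := by
  rw [← Tropical.untrop_le_iff]
  exact WithTop.coe_le_coe

theorem ofReal_add_ofReal (r s : ℝ) : ofReal r + ofReal s = ofReal (max r s) := by
  rcases le_total r s with h | h
  · rw [max_eq_right h, Tropical.add_eq_right (ofReal_le_ofReal.2 h)]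
  · rw [max_eq_left h, Tropical.add_eq_left (ofReal_le_ofReal.2 h)]

/-! ### Terms of tropical Laurent polynomials -/

/-- The term `r ⊙ X^m`, recorded as the pair `(r, m)`. -/
abbrev Term (n : ℕ) : Type := ℝ × (Fin n → ℤ)


/-- `a = (r, m)` is a term of `f`: the coefficient of `X^m` in `f` is the real number `r`. -/
def IsTerm (f : Laurent n) (a : Term n) : Prop := f.coeff a.2 = ofReal a.1

/-- The Laurent monomial with the single term `a`. -/
def mono (a : Term n) : Laurent n := AddMonoidAlgebra.single a.2 (ofReal a.1)

theorem mono_add (a b : Term n) : mono (a + b) = mono a * mono b := by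
  simp [mono, AddMonoidAlgebra.single_mul_single, ofReal_mul_ofReal]

theorem mono_zero : mono (0 : Term n) = 1 := rfl

theorem isTerm_mono_iff {a b : Term n} : IsTerm (mono a) b ↔ b = a := by
  simp only [IsTerm, mono, AddMonoidAlgebra.coeff_single, Finsupp.single_apply]
  split_ifs with h
  · constructor
    · intro h'
      exact Prod.ext (ofReal_injective h').symm h.symm
    · rintro rfl
      rfl
  · constructor
    · intro h'
      exact absurd h'.symm (ofReal_ne_zero _)
    · rintro rfl
      exact absurd rfl h

theorem not_isTerm_zero (a : Term n) : ¬ IsTerm 0 a := by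
  intro h
  simp only [IsTerm, AddMonoidAlgebra.coeff_zero, Finsupp.coe_zero, Pi.zero_apply] at h
  exact ofReal_ne_zero _ h.symm

theorem exists_isTerm_of_coeff_ne_zero {f : Laurent n} {m : Fin n → ℤ} (h : f.coeff m ≠ 0) :
    ∃ r, IsTerm f (r, m) :=
  (eq_zero_or_eq_ofReal _).resolve_left h

theorem IsTerm.mem_support {f : Laurent n} {a : Term n} (h : IsTerm f a) :
    a.2 ∈ f.coeff.support := by
  rw [Finsupp.mem_support_iff, h]
  exact ofReal_ne_zero _

theorem IsTerm.of_add {f g : Laurent n} {a : Term n} (h : IsTerm (f + g) a) :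
    IsTerm f a ∨ IsTerm g a := by
  have h' : f.coeff a.2 + g.coeff a.2 = ofReal a.1 := h
  rcases (Tropical.add_eq_iff.1 h') with h | h
  · exact Or.inl h.1
  · exact Or.inr h.1

theorem IsTerm.exists_add {f : Laurent n} {a : Term n} (h : IsTerm f a) (g : Laurent n) :
    ∃ b, IsTerm (f + g) b ∧ b.2 = a.2 ∧ a.1 ≤ b.1 := by
  have h' : f.coeff a.2 = ofReal a.1 := h
  rcases eq_zero_or_eq_ofReal (g.coeff a.2) with hg | ⟨s, hg⟩
  · refine ⟨a, ?_, rfl, le_rfl⟩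
    change f.coeff a.2 + g.coeff a.2 = _
    rw [hg, h', add_zero]
  · refine ⟨(max a.1 s, a.2), ?_, rfl, le_max_left _ _⟩
    change f.coeff a.2 + g.coeff a.2 = _
    rw [hg, h', ofReal_add_ofReal]

theorem isTerm_mul_mono {f : Laurent n} {a b : Term n} :
    IsTerm (f * mono a) b ↔ IsTerm f (b - a) := by
  have : (f * mono a).coeff b.2 = f.coeff (b.2 - a.2) * ofReal a.1 := by
    have := AddMonoidAlgebra.coeff_mul_single_eq_coeff_mul (x := f) (r := ofReal a.1)
      (m := a.2) (m₁ := b.2) (b.2 - a.2) (fun x _ => by rw [eq_sub_iff_add_eq])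
    simpa [mono] using this
  simp only [IsTerm, this, Prod.fst_sub, Prod.snd_sub]
  rcases eq_zero_or_eq_ofReal (f.coeff (b.2 - a.2)) with h | ⟨r, h⟩
  · simp [h, (ofReal_ne_zero _).symm]
  · rw [h, ofReal_mul_ofReal, ofReal_injective.eq_iff, ofReal_injective.eq_iff, eq_sub_iff_add_eq]

theorem laurent_induction {p : Laurent n → Prop} (f : Laurent n) (zero : p 0)
    (add : ∀ f g, p f → p g → p (f + g)) (mono : ∀ a, p (mono a)) : p f := by
  induction f using AddMonoidAlgebra.induction_linear with
  | zero => exact zero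
  | add f g hf hg => exact add f g hf hg
  | single m c =>
    rcases eq_zero_or_eq_ofReal c with rfl | ⟨r, rfl⟩
    · simpa using zero
    · exact mono (r, m)

theorem laurent_add_self (f : Laurent n) : f + f = f :=
  AddMonoidAlgebra.coeff_injective (Finsupp.ext fun _ => Tropical.add_self _)

/-! ### Total cones and the congruences they define -/

/-- The set of nonnegative elements of a total group preorder on the group of terms that extends
the order of `ℝ`. -/
structure TotalCone (n : ℕ) extends AddSubmonoid (Term n) where
  total' : ∀ a, a ∈ carrier ∨ -a ∈ carrier
  nonneg' : ∀ r : ℝ, 0 ≤ r → (r, 0) ∈ carrier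

namespace TotalCone

instance : SetLike (TotalCone n) (Term n) where
  coe N := N.carrier
  coe_injective N M h := by
    obtain ⟨N, _, _⟩ := N
    obtain ⟨M, _, _⟩ := M
    congr
    exact SetLike.coe_injective h

instance : PartialOrder (TotalCone n) := .ofSetLike (TotalCone n) (Term n)

instance : AddSubmonoidClass (TotalCone n) (Term n) where
  add_mem {N} _ _ h h' := N.add_mem' h h'
  zero_mem N := N.zero_mem'

variable (N : TotalCone n)

theorem total (a : Term n) : a ∈ N ∨ -a ∈ N := N.total' a

theorem nonneg {r : ℝ} (h : 0 ≤ r) : ((r, 0) : Term n) ∈ N := N.nonneg' r h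

/-- Every term of `f` is dominated by a term of `g`. -/
def dom (f g : Laurent n) : Prop := ∀ a, IsTerm f a → ∃ b, IsTerm g b ∧ b - a ∈ N

variable {N} {f g h k : Laurent n}

theorem dom_refl (f : Laurent n) : N.dom f f := fun a ha => ⟨a, ha, by simp [zero_mem]⟩

theorem dom.trans (h₁ : N.dom f g) (h₂ : N.dom g h) : N.dom f h := by
  intro a ha
  obtain ⟨b, hb, hab⟩ := h₁ a ha
  obtain ⟨c, hc, hbc⟩ := h₂ b hb
  exact ⟨c, hc, by simpa using add_mem hbc hab⟩

theorem zero_dom (f : Laurent n) : N.dom 0 f := fun a ha => absurd ha (not_isTerm_zero a)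

theorem dom_add_left (f g : Laurent n) : N.dom f (f + g) := by
  intro a ha
  obtain ⟨b, hb, h2, h1⟩ := ha.exists_add g
  refine ⟨b, hb, ?_⟩
  have : b - a = (b.1 - a.1, 0) := Prod.ext rfl (by simp [h2])
  rw [this]
  exact N.nonneg (by linarith)

theorem dom_add_right (f g : Laurent n) : N.dom g (f + g) := by
  rw [add_comm]
  exact dom_add_left g f

theorem dom.add_le (h₁ : N.dom f h) (h₂ : N.dom g h) : N.dom (f + g) h :=
  fun a ha => ha.of_add.elim (h₁ a) (h₂ a)

theorem dom.add (h₁ : N.dom f h) (h₂ : N.dom g k) : N.dom (f + g) (h + k) :=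
  (h₁.trans (dom_add_left h k)).add_le (h₂.trans (dom_add_right h k))

theorem dom.mul_mono (h₁ : N.dom f g) (c : Term n) : N.dom (f * mono c) (g * mono c) := by
  intro a ha
  obtain ⟨b, hb, hab⟩ := h₁ _ (isTerm_mul_mono.1 ha)
  exact ⟨b + c, isTerm_mul_mono.2 (by simpa using hb), by
    rwa [show b + c - a = b - (a - c) by abel]⟩

theorem dom.mul_right (h₁ : N.dom f g) (h : Laurent n) : N.dom (f * h) (g * h) := by
  induction h using laurent_induction with
  | zero => simpa using dom_refl 0
  | add h k hh hk => simpa [mul_add] using hh.add hk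
  | mono a => exact h₁.mul_mono a

theorem dom.mul (h₁ : N.dom f g) (h₂ : N.dom h k) : N.dom (f * h) (g * k) := by
  have := h₂.mul_right g
  rw [mul_comm h, mul_comm k] at this
  exact (h₁.mul_right h).trans this

theorem dom_mono_mono {a b : Term n} : N.dom (mono a) (mono b) ↔ b - a ∈ N := by
  simp [dom, isTerm_mono_iff]

theorem dom_mono_of_isTerm {a : Term n} (ha : IsTerm f a) : N.dom (mono a) f := by
  intro b hb
  rw [isTerm_mono_iff.1 hb]
  exact ⟨a, ha, by simp [zero_mem]⟩

theorem dom_total (N : TotalCone n) (f g : Laurent n) : N.dom f g ∨ N.dom g f := by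
  by_contra! h
  simp only [dom] at h
  push Not at h
  obtain ⟨⟨a, ha, hag⟩, ⟨b, hb, hbf⟩⟩ := h
  have h1 := (N.total (b - a)).resolve_left (hag b hb)
  exact hbf a ha (by simpa using h1)

/-- A nonzero polynomial has a dominating term. -/
theorem exists_leading (N : TotalCone n) (hf : f ≠ 0) :
    ∃ a, IsTerm f a ∧ N.dom f (mono a) := by
  -- The induction only claims a monomial equivalent to f: a term of a summand may be absorbed by a
  -- larger coefficient of the sum. An actual term is extracted at the end.
  have key : ∀ f : Laurent n, f = 0 ∨ ∃ a, N.dom (mono a) f ∧ N.dom f (mono a) := by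
    intro f
    induction f using laurent_induction with
    | zero => exact Or.inl rfl
    | add f g hf hg =>
      rcases hf with rfl | ⟨a, haf, hfa⟩
      · simpa using hg
      rcases hg with rfl | ⟨b, hbg, hgb⟩
      · exact Or.inr ⟨a, by simpa using haf, by simpa using hfa⟩
      right
      rcases N.dom_total (mono a) (mono b) with h | h
      · exact ⟨b, hbg.trans (dom_add_right _ _), (hfa.trans h).add_le hgb⟩
      · exact ⟨a, haf.trans (dom_add_left _ _), hfa.add_le (hgb.trans h)⟩
    | mono a => exact Or.inr ⟨a, dom_refl _, dom_refl _⟩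
  obtain ⟨a, haf, hfa⟩ := (key f).resolve_left hf
  obtain ⟨b, hb, hab⟩ := haf a (isTerm_mono_iff.2 rfl)
  exact ⟨b, hb, hfa.trans (dom_mono_mono.2 hab)⟩

/-- Strict domination is preserved by multiplication with a nonzero polynomial. -/
theorem dom_of_mul_dom_mul (hh : h ≠ 0) (h₁ : N.dom (f * h) (g * h)) : N.dom f g := by
  obtain ⟨a, ha, hha⟩ := N.exists_leading hh
  have h2 : N.dom (f * mono a) (g * mono a) :=
    ((dom_refl f).mul (dom_mono_of_isTerm ha)).trans (h₁.trans ((dom_refl g).mul hha))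
  have h3 := h2.mul_mono (-a)
  rwa [mul_assoc, mul_assoc, ← mono_add, add_neg_cancel, mono_zero, mul_one, mul_one] at h3

variable (N) in
/-- The congruence identifying polynomials that dominate each other. -/
def cong : RingCon (Laurent n) where
  r f g := N.dom f g ∧ N.dom g f
  iseqv :=
    { refl := fun f => ⟨dom_refl f, dom_refl f⟩
      symm := fun h => ⟨h.2, h.1⟩
      trans := fun h h' => ⟨h.1.trans h'.1, h'.2.trans h.2⟩ }
  add' h h' := ⟨h.1.add h'.1, h.2.add h'.2⟩
  mul' h h' := ⟨h.1.mul h'.1, h.2.mul h'.2⟩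

theorem cong_iff : N.cong f g ↔ N.dom f g ∧ N.dom g f := Iff.rfl

/-- In the total preorder of domination, a < b and c < d give ad + bc < bd: a sum is equivalent to
its larger summand, and nonzero factors cancel. This is the core of primality. -/
theorem not_dom_of_lt_of_lt {a b c d : Laurent n} (hab : ¬ N.dom b a) (hcd : ¬ N.dom d c) :
    ¬ N.dom (b * d) (a * d + b * c) := by
  intro h
  have hb : b ≠ 0 := by
    rintro rfl
    exact hab (zero_dom a)
  have hd : d ≠ 0 := by
    rintro rfl
    exact hcd (zero_dom c)
  rcases N.dom_total (a * d) (b * c) with h' | h'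
  · have := h.trans (h'.add_le (dom_refl _))
    rw [mul_comm b, mul_comm b] at this
    exact hcd (dom_of_mul_dom_mul hb this)
  · exact hab (dom_of_mul_dom_mul hd (h.trans ((dom_refl _).add_le h')))

theorem isPrimeCong_cong (N : TotalCone n) : IsPrimeCong N.cong := by
  refine ⟨fun h => ?_, fun a b c d h => ?_⟩
  · have : N.cong (mono 0) 0 := by rw [h]; trivial
    obtain ⟨b, hb, -⟩ := this.1 0 (isTerm_mono_iff.2 rfl)
    exact not_isTerm_zero b hb
  · by_contra! hcon
    simp only [cong_iff, not_and_or] at hcon h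
    obtain ⟨h1, h2⟩ := hcon
    -- Both pairs are strictly ordered. In each of the four cases the product of the two larger
    -- elements is a summand of one side of h, hence dominated by the other side.
    rcases h1 with h1 | h1 <;> rcases h2 with h2 | h2
    · refine not_dom_of_lt_of_lt h1 h2 ((dom_add_left _ _).trans (h.1.trans ?_))
      rw [add_comm, mul_comm b c, mul_comm a d, mul_comm c b, mul_comm d a]
      exact dom_refl _
    · refine not_dom_of_lt_of_lt h1 h2 ((dom_add_left _ _).trans (h.2.trans ?_))
      rw [add_comm]
      exact dom_refl _
    · refine not_dom_of_lt_of_lt h1 h2 ((dom_add_right _ _).trans (h.2.trans ?_))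
      exact dom_refl _
    · refine not_dom_of_lt_of_lt h1 h2 ((dom_add_right _ _).trans (h.1.trans ?_))
      exact dom_refl _

theorem cong_mono {N M : TotalCone n} (h : N ≤ M) : N.cong ≤ M.cong := by
  have key : ∀ f g, N.dom f g → M.dom f g := fun f g hfg a ha => by
    obtain ⟨b, hb, hab⟩ := hfg a ha
    exact ⟨b, hb, h hab⟩
  intro f g hfg
  exact ⟨key _ _ hfg.1, key _ _ hfg.2⟩

/-- Comparison of two cones on all differences of terms of `f` and `g` determines the relation. -/
theorem dom_of_imp {N M : TotalCone n} (hfg : N.dom f g)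
    (h : ∀ a b, IsTerm f a → IsTerm g b → b - a ∈ N → b - a ∈ M) : M.dom f g := by
  intro a ha
  obtain ⟨b, hb, hab⟩ := hfg a ha
  exact ⟨b, hb, h a b ha hb hab⟩

end TotalCone

/-! ### Prime congruences come from total cones -/

theorem RingCon.eq_top_of_one_zero {R : Type*} [CommSemiring R] {E : RingCon R} (h : E 1 0) :
    E = ⊤ := by
  refine top_unique fun x y _ => ?_
  have key : ∀ z, E z 0 := fun z => by simpa using E.mul (E.refl z) h
  exact E.trans (key x) (E.symm (key y))

theorem IsTerm.mono_add_self {f : Laurent n} {a : Term n} (ha : IsTerm f a) :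
    mono a + f = f := by
  refine AddMonoidAlgebra.coeff_injective (Finsupp.ext fun m => ?_)
  rw [AddMonoidAlgebra.coeff_add, Finsupp.add_apply, mono, AddMonoidAlgebra.coeff_single,
    Finsupp.single_apply]
  split_ifs with hm
  · subst hm
    rw [show f.coeff a.2 = ofReal a.1 from ha]
    exact Tropical.add_self _
  · rw [zero_add]

namespace IsPrimeCong

variable {E : RingCon (Laurent n)} (hE : IsPrimeCong E)
include hE

/-- Primality for the pairs (f + g, f) and (f + g, g): by idempotence both mixed products equal f² +
fg + g². So the quotient is totally ordered. -/
theorem rel_add_or (f g : Laurent n) : E (f + g) f ∨ E (f + g) g := by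
  refine hE.2 (f + g) f (f + g) g ?_
  have : (f + g) * (f + g) + f * g = (f + g) * g + f * (f + g) := by
    have h1 : (f + g) * (f + g) + f * g = f * f + (f * g + f * g) + g * g + f * g := by ring
    have h2 : (f + g) * g + f * (f + g) = f * f + (f * g + f * g) + g * g := by ring
    rw [h1, h2, laurent_add_self, add_right_comm, add_assoc (f * f), laurent_add_self]
  rw [this]
  exact E.refl _

theorem not_rel_mono_zero (a : Term n) : ¬ E (mono a) 0 := by
  intro h
  refine hE.1 (RingCon.eq_top_of_one_zero ?_)
  have := E.mul h (E.refl (mono (-a)))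
  rwa [← mono_add, add_neg_cancel, mono_zero, zero_mul] at this

/-- The cone of terms that are at least `1` modulo a prime congruence. -/
def cone : TotalCone n where
  carrier := {a | E (mono a + 1) (mono a)}
  zero_mem' := by
    change E (mono 0 + 1) (mono 0)
    rw [mono_zero, laurent_add_self]
    exact E.refl _
  add_mem' {a b} ha hb := by
    change E (mono (a + b) + 1) (mono (a + b))
    have h1 : E (mono (a + b) + mono b) (mono (a + b)) := by
      have := E.mul ha (E.refl (mono b))
      rwa [add_mul, one_mul, ← mono_add] at this
    have h2 := E.add (E.symm h1) (E.refl 1)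
    rw [add_assoc] at h2
    exact E.trans (E.trans h2 (E.add (E.refl _) hb)) h1
  total' a := by
    rcases rel_add_or hE (mono a) 1 with h | h
    · exact Or.inl h
    · right
      change E (mono (-a) + 1) (mono (-a))
      have := E.mul h (E.refl (mono (-a)))
      rwa [add_mul, one_mul, ← mono_add, add_neg_cancel, mono_zero, add_comm] at this
  nonneg' r hr := by
    change E (mono (r, 0) + 1) (mono (r, 0))
    have : mono ((r, 0) : Term n) + 1 = mono (r, 0) := by
      rw [← mono_zero, mono, mono, Prod.snd_zero, ← AddMonoidAlgebra.single_add, Prod.fst_zero,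
        ofReal_add_ofReal, max_eq_left hr]
    rw [this]
    exact E.refl _

theorem mem_cone {a : Term n} : a ∈ cone hE ↔ E (mono a + 1) (mono a) := Iff.rfl

theorem rel_mono_add_mono_iff {a b : Term n} :
    E (mono a + mono b) (mono b) ↔ b - a ∈ cone hE := by
  rw [mem_cone]
  constructor
  · intro h
    have := E.mul h (E.refl (mono (-a)))
    rwa [add_mul, ← mono_add, ← mono_add, add_neg_cancel, ← sub_eq_add_neg, mono_zero,
      add_comm] at this
  · intro h
    have := E.mul h (E.refl (mono a))
    rwa [add_mul, one_mul, ← mono_add, sub_add_cancel, add_comm] at this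

omit hE in
theorem rel_add_trans {f g h : Laurent n} (h₁ : E (f + g) g) (h₂ : E (g + h) h) :
    E (f + h) h := by
  have h3 := E.add (E.refl f) (E.symm h₂)
  rw [← add_assoc] at h3
  exact E.trans (E.trans h3 (E.add h₁ (E.refl h))) h₂

/-- `E (f + g) g` is the order f ≤ g of the idempotent quotient. One direction is an additive
induction on f; the other is one on g, where a sum is related to one of its summands. -/
theorem dom_cone_iff {f g : Laurent n} : (cone hE).dom f g ↔ E (f + g) g := by
  constructor
  · intro h
    have key : ∀ f' : Laurent n, (cone hE).dom f' g → E (f' + g) g := by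
      intro f'
      induction f' using laurent_induction with
      | zero => intro _; simpa using E.refl g
      | add f₁ f₂ h₁ h₂ =>
        intro h
        have h1 := E.add (E.refl f₁) (h₂ ((TotalCone.dom_add_right _ _).trans h))
        rw [← add_assoc] at h1
        exact E.trans h1 (h₁ ((TotalCone.dom_add_left _ _).trans h))
      | mono a =>
        intro h
        obtain ⟨b, hb, hab⟩ := h a (isTerm_mono_iff.2 rfl)
        refine rel_add_trans ((rel_mono_add_mono_iff hE).2 hab) ?_
        rw [hb.mono_add_self]
        exact E.refl _
    exact key f h
  · intro h a ha
    have h1 : E (mono a + f) f := by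
      rw [ha.mono_add_self]
      exact E.refl _
    have h2 := rel_add_trans h1 h
    clear h h1 ha
    -- A term of a summand of g may be absorbed by a larger coefficient at the same exponent, so the
    -- induction only asks for b to lie below such a term.
    suffices ∃ b, (∃ c, IsTerm g c ∧ c.2 = b.2 ∧ b.1 ≤ c.1) ∧ b - a ∈ cone hE by
      obtain ⟨b, ⟨c, hc, hcb, hbc⟩, hb⟩ := this
      refine ⟨c, hc, ?_⟩
      have h3 : (c.1 - b.1, 0) + (b - a) ∈ cone hE :=
        add_mem ((cone hE).nonneg (sub_nonneg.2 hbc)) hb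
      convert h3 using 1
      ext <;> simp [hcb]
    induction g using laurent_induction with
    | zero =>
      rw [add_zero] at h2
      exact absurd h2 (not_rel_mono_zero hE a)
    | add g₁ g₂ hg₁ hg₂ =>
      rcases rel_add_or hE g₁ g₂ with h | h
      · obtain ⟨b, ⟨c, hc, hcb, hbc⟩, hb⟩ := hg₁
          (E.trans (E.trans (E.add (E.refl _) (E.symm h)) h2) h)
        obtain ⟨d, hd, hd2, hd1⟩ := hc.exists_add g₂
        exact ⟨b, ⟨d, hd, hd2.trans hcb, hbc.trans hd1⟩, hb⟩
      · obtain ⟨b, ⟨c, hc, hcb, hbc⟩, hb⟩ := hg₂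
          (E.trans (E.trans (E.add (E.refl _) (E.symm h)) h2) h)
        obtain ⟨d, hd, hd2, hd1⟩ := hc.exists_add g₁
        rw [add_comm g₂] at hd
        exact ⟨b, ⟨d, hd, hd2.trans hcb, hbc.trans hd1⟩, hb⟩
    | mono b =>
      exact ⟨b, ⟨b, isTerm_mono_iff.2 rfl, rfl, le_rfl⟩, (rel_mono_add_mono_iff hE).1 h2⟩

theorem cong_cone : (cone hE).cong = E := by
  refine RingCon.ext fun f g => ?_
  rw [TotalCone.cong_iff, dom_cone_iff, dom_cone_iff]
  constructor
  · rintro ⟨h1, h2⟩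
    rw [add_comm] at h2
    exact E.trans (E.symm h2) h1
  · intro h
    constructor
    · have := E.add h (E.refl g)
      rwa [laurent_add_self] at this
    · have := E.add (E.symm h) (E.refl f)
      rwa [laurent_add_self] at this

end IsPrimeCong

/-- The cone can be read off its congruence: a is nonnegative exactly if `mono a + 1` is related to
`mono a`. -/
theorem TotalCone.le_of_cong_le {N M : TotalCone n} (h : N.cong ≤ M.cong) : N ≤ M := by
  intro a ha
  have h1 : N.cong (mono a + mono 0) (mono a) :=
    ⟨(dom_refl _).add_le (dom_mono_mono.2 (by simpa using ha)), dom_add_left _ _⟩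
  have := (dom_add_right _ _).trans (h h1).1
  simpa using dom_mono_mono.1 this

theorem TotalCone.cong_le_cong_iff {N M : TotalCone n} : N.cong ≤ M.cong ↔ N ≤ M :=
  ⟨le_of_cong_le, cong_mono⟩

/-! ### Evaluation -/

/-- The value of the term `a` at the point `x`. -/
def termVal (x : Fin n → ℝ) (a : Term n) : ℝ := a.1 + ∑ i, (a.2 i : ℝ) * x i

theorem termVal_add (x : Fin n → ℝ) (a b : Term n) :
    termVal x (a + b) = termVal x a + termVal x b := by
  simp [termVal, add_mul, Finset.sum_add_distrib]
  ring

theorem termVal_zero (x : Fin n → ℝ) : termVal x 0 = 0 := by simp [termVal]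

theorem termVal_neg (x : Fin n → ℝ) (a : Term n) : termVal x (-a) = -termVal x a := by
  simp [termVal]
  ring

theorem termVal_sub (x : Fin n → ℝ) (a b : Term n) :
    termVal x (a - b) = termVal x a - termVal x b := by
  rw [sub_eq_add_neg, termVal_add, termVal_neg, sub_eq_add_neg]

theorem termVal_point_add (x w : Fin n → ℝ) (a : Term n) :
    termVal (x + w) a = termVal x a + ∑ i, (a.2 i : ℝ) * w i := by
  simp [termVal, mul_add, Finset.sum_add_distrib]
  ring

/-- The cone of terms that are nonnegative at the point `x`. -/
def pointCone (x : Fin n → ℝ) : TotalCone n where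
  carrier := {a | 0 ≤ termVal x a}
  zero_mem' := (termVal_zero x).ge
  add_mem' {a b} ha hb := by
    change 0 ≤ termVal x (a + b)
    rw [termVal_add]
    exact add_nonneg ha hb
  total' a := by
    change 0 ≤ termVal x a ∨ 0 ≤ termVal x (-a)
    rw [termVal_neg, Left.nonneg_neg_iff]
    exact le_total _ _
  nonneg' r hr := by
    change 0 ≤ termVal x (r, 0)
    simpa [termVal] using hr

theorem mem_pointCone {x : Fin n → ℝ} {a : Term n} : a ∈ pointCone x ↔ 0 ≤ termVal x a := Iff.rfl

/-- The order of `T` is reversed, so the left side means f(x) ≤ g(x) for the real maxima. -/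
theorem eval_le_eval_iff {f g : Laurent n} {x : Fin n → ℝ} :
    eval g x ≤ eval f x ↔ (pointCone x).dom f g := by
  -- The condition c ≠ 0 matters: `0` is the largest element of `T`, so it lies above `eval h x`
  -- even if h has no terms.
  have hsum : ∀ (h : Laurent n) (c : T), (c ≠ 0 → (eval h x ≤ c ↔
      ∃ a, IsTerm h a ∧ ofReal (termVal x a) ≤ c)) ∧
      (c ≤ eval h x ↔ ∀ a, IsTerm h a → c ≤ ofReal (termVal x a)) := by
    intro h c
    have hval : ∀ a, IsTerm h a → h.coeff a.2 * ofReal (∑ i, (a.2 i : ℝ) * x i) =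
        ofReal (termVal x a) := fun a ha => by
      rw [show h.coeff a.2 = ofReal a.1 from ha, ofReal_mul_ofReal]
      rfl
    constructor
    · intro hc
      rw [eval, ← Tropical.untrop_le_iff, Finset.untrop_sum', Finset.inf_le_iff]
      · constructor
        · rintro ⟨m, hm, hmc⟩
          obtain ⟨r, hr⟩ := exists_isTerm_of_coeff_ne_zero (Finsupp.mem_support_iff.1 hm)
          exact ⟨(r, m), hr, by rw [← hval _ hr]; exact hmc⟩
        · rintro ⟨a, ha, hac⟩
          refine ⟨a.2, ha.mem_support, ?_⟩
          rw [← hval a ha] at hac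
          exact hac
      · exact lt_top_iff_ne_top.2 fun h => hc (congrArg Tropical.trop h)
    · rw [eval, ← Tropical.untrop_le_iff, Finset.untrop_sum', Finset.le_inf_iff]
      constructor
      · intro H a ha
        rw [← hval a ha]
        exact H a.2 ha.mem_support
      · intro H m hm
        obtain ⟨r, hr⟩ := exists_isTerm_of_coeff_ne_zero (Finsupp.mem_support_iff.1 hm)
        have := H _ hr
        rw [← hval _ hr] at this
        exact this
  rw [(hsum f _).2]
  refine forall₂_congr fun a _ => ?_
  rw [(hsum g _).1 (ofReal_ne_zero _)]
  refine exists_congr fun b => and_congr_right fun _ => ?_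
  rw [ofReal_le_ofReal, mem_pointCone, termVal_sub, sub_nonneg]

theorem eval_eq_eval_iff {f g : Laurent n} {x : Fin n → ℝ} :
    eval f x = eval g x ↔ (pointCone x).cong f g := by
  rw [TotalCone.cong_iff, ← eval_le_eval_iff, ← eval_le_eval_iff, le_antisymm_iff, and_comm]

theorem mem_congVariety_iff {S : Set (Laurent n × Laurent n)} {x : Fin n → ℝ} :
    x ∈ congVariety S ↔ ∀ p ∈ S, (pointCone x).cong p.1 p.2 := by
  simp only [congVariety, Set.mem_ofPred_eq, eval_eq_eval_iff]

/-- The finitely many terms of a tropical Laurent polynomial. -/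
theorem finite_setOf_isTerm (f : Laurent n) : {a | IsTerm f a}.Finite := by
  refine Set.Finite.of_finite_image (f := Prod.snd) (f.coeff.support.finite_toSet.subset ?_) ?_
  · rintro _ ⟨a, ha, rfl⟩
    exact IsTerm.mem_support ha
  · intro a ha b hb hab
    refine Prod.ext (ofReal_injective ?_) hab
    rw [← show f.coeff a.2 = ofReal a.1 from ha, ← show f.coeff b.2 = ofReal b.1 from hb, hab]

/-- All differences of terms of the polynomials occurring in `S`. -/
def termDiffs (S : Set (Laurent n × Laurent n)) : Set (Term n) :=
  {d | ∃ p ∈ S, ∃ a b, (IsTerm p.1 a ∨ IsTerm p.2 a) ∧ (IsTerm p.1 b ∨ IsTerm p.2 b) ∧ d = b - a}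

theorem finite_termDiffs {S : Set (Laurent n × Laurent n)} (hS : S.Finite) :
    (termDiffs S).Finite := by
  have : termDiffs S ⊆ ⋃ p ∈ S, Set.image2 (fun a b => b - a)
      ({a | IsTerm p.1 a} ∪ {a | IsTerm p.2 a}) ({a | IsTerm p.1 a} ∪ {a | IsTerm p.2 a}) := by
    rintro d ⟨p, hp, a, b, ha, hb, rfl⟩
    exact Set.mem_biUnion hp ⟨a, ha, b, hb, rfl⟩
  refine (hS.biUnion fun p _ => ?_).subset this
  exact Set.Finite.image2 _ ((finite_setOf_isTerm _).union (finite_setOf_isTerm _))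
    ((finite_setOf_isTerm _).union (finite_setOf_isTerm _))

theorem neg_mem_termDiffs {S : Set (Laurent n × Laurent n)} {d : Term n} (h : d ∈ termDiffs S) :
    -d ∈ termDiffs S := by
  obtain ⟨p, hp, a, b, ha, hb, rfl⟩ := h
  exact ⟨p, hp, b, a, hb, ha, by abel⟩

/-- If two cones agree on the differences of terms, then they identify the same pairs. -/
theorem TotalCone.cong_of_termDiffs {N M : TotalCone n} {S : Set (Laurent n × Laurent n)}
    (h : ∀ d ∈ termDiffs S, d ∈ N → d ∈ M) {p : Laurent n × Laurent n} (hp : p ∈ S)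
    (hN : N.cong p.1 p.2) : M.cong p.1 p.2 :=
  ⟨dom_of_imp hN.1 fun a b ha hb => h _ ⟨p, hp, a, b, Or.inl ha, Or.inr hb, rfl⟩,
    dom_of_imp hN.2 fun a b ha hb => h _ ⟨p, hp, a, b, Or.inr ha, Or.inl hb, rfl⟩⟩

/-! ### Realizing a total cone on finitely many terms -/

namespace TotalCone

variable {N : TotalCone n}

theorem zsmul_mem {k : ℤ} (hk : 0 ≤ k) {a : Term n} (ha : a ∈ N) : k • a ∈ N := by
  lift k to ℕ using hk
  rw [natCast_zsmul]
  exact nsmul_mem ha k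

theorem mem_of_zsmul_mem {k : ℤ} (hk : 0 < k) {a : Term n} (ha : k • a ∈ N) : a ∈ N := by
  rcases N.total a with h | h
  · exact h
  · have := add_mem ha (zsmul_mem (k := k - 1) (by omega) h)
    rwa [smul_neg, ← sub_eq_add_neg, ← sub_smul, sub_sub_cancel, one_smul] at this

theorem zsmul_mem_iff {k : ℤ} (hk : 0 < k) {a : Term n} : k • a ∈ N ↔ a ∈ N :=
  ⟨mem_of_zsmul_mem hk, zsmul_mem hk.le⟩

theorem real_mem_iff (hN : ((-1, 0) : Term n) ∉ N) {r : ℝ} : ((r, 0) : Term n) ∈ N ↔ 0 ≤ r := by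
  refine ⟨fun h => ?_, N.nonneg⟩
  by_contra! hr
  obtain ⟨k, hk⟩ := exists_nat_gt (-1 / r)
  refine hN ?_
  have h1 : ((-1 - k * r, 0) : Term n) ∈ N := N.nonneg (by
    rw [div_lt_iff_of_neg hr] at hk
    linarith)
  have := add_mem (nsmul_mem h k) h1
  convert this using 1
  ext <;> simp

end TotalCone

theorem termVal_zsmul (x : Fin n → ℝ) (k : ℤ) (a : Term n) :
    termVal x (k • a) = k * termVal x a := by
  simp [termVal, mul_add, Finset.mul_sum, mul_assoc]

theorem termVal_add_single (x : Fin n → ℝ) (i : Fin n) (t : ℝ) (a : Term n) :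
    termVal (x + Pi.single i t) a = termVal x a + a.2 i * t := by
  rw [termVal_point_add]
  simp [Pi.single_apply]

/-- Fourier–Motzkin elimination, by induction on the coordinates that occur. The induction
hypothesis realizes the signs of the terms without the variable i and of the combinations that
eliminate i from two terms; then only coordinate i is shifted. -/
theorem exists_matching_of_support {N : TotalCone n} (hN : ((-1, 0) : Term n) ∉ N)
    (s : Finset (Fin n)) : ∀ F : Set (Term n), F.Finite → (∀ a ∈ F, ∀ i ∉ s, a.2 i = 0) →
      ∃ x : Fin n → ℝ, ∀ a ∈ F, (a ∈ N ↔ 0 ≤ termVal x a) := by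
  induction s using Finset.induction_on with
  | empty =>
    intro F _ hF
    refine ⟨0, fun a ha => ?_⟩
    have h2 : a = (a.1, 0) := Prod.ext rfl (funext fun i => hF a ha i (by simp))
    rw [h2, TotalCone.real_mem_iff hN]
    simp [termVal]
  | insert i s hi ih =>
    intro F hfin hF
    set F1 : Set (Term n) := F ∪ (fun a => -a) '' F with hF1
    have hF1fin : F1.Finite := hfin.union (hfin.image _)
    have hF1s : ∀ a ∈ F1, ∀ j ∉ insert i s, a.2 j = 0 := by
      rintro a (ha | ⟨a, ha, rfl⟩) j hj
      · exact hF a ha j hj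
      · simp [hF a ha j hj]
    obtain ⟨x, hx⟩ := ih ({a ∈ F1 | a.2 i = 0} ∪
        Set.image2 (fun a b => a.2 i • b - b.2 i • a) F1 F1)
      ((hF1fin.subset fun a ha => ha.1).union (Set.Finite.image2 _ hF1fin hF1fin)) (by
        rintro a (ha | ⟨a, ha, b, hb, rfl⟩) j hj
        · by_cases hji : j = i
          · rw [hji]
            exact ha.2
          · exact hF1s a ha.1 j (by simp [hji, hj])
        · by_cases hji : j = i
          · subst hji
            simp [mul_comm]
          · simp [hF1s a ha j (by simp [hji, hj]), hF1s b hb j (by simp [hji, hj])])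
    -- For a positive coefficient at i, the term a is nonnegative after a shift by t exactly if θ a
    -- ≤ t. Closing F under negation has made this case sufficient.
    let θ : Term n → ℝ := fun a => -termVal x a / a.2 i
    have key : ∀ a ∈ F1, ∀ b ∈ F1, 0 < a.2 i → 0 < b.2 i →
        (a.2 i • b - b.2 i • a ∈ N ↔ θ b ≤ θ a) := by
      intro a ha b hb hai hbi
      have hai' : (0 : ℝ) < a.2 i := by exact_mod_cast hai
      have hbi' : (0 : ℝ) < b.2 i := by exact_mod_cast hbi
      rw [hx _ (Or.inr ⟨a, ha, b, hb, rfl⟩), termVal_sub, termVal_zsmul, termVal_zsmul,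
        div_le_div_iff₀ hbi' hai']
      constructor <;> intro h <;> nlinarith
    have main : ∃ t : ℝ, ∀ a ∈ F1, 0 < a.2 i → (a ∈ N ↔ θ a ≤ t) ∧ (-a ∈ N ↔ t ≤ θ a) := by
      -- A term equivalent to 0 forces t to be its threshold. Otherwise t is put strictly between
      -- the thresholds of terms in N and of terms whose negatives are in N; `key` shows that these
      -- are correctly ordered.
      by_cases hz : ∃ a ∈ F1, 0 < a.2 i ∧ a ∈ N ∧ -a ∈ N
      · obtain ⟨a, ha, hai, haN, haN'⟩ := hz
        refine ⟨θ a, fun b hb hbi => ?_⟩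
        rw [← key a ha b hb hai hbi, ← key b hb a ha hbi hai]
        have h1 := TotalCone.zsmul_mem hbi.le haN
        have h2 := TotalCone.zsmul_mem hbi.le haN'
        constructor
        · rw [← TotalCone.zsmul_mem_iff (N := N) hai]
          constructor
          · intro h
            simpa [sub_eq_add_neg] using add_mem h h2
          · intro h
            simpa using add_mem h h1
        · rw [← TotalCone.zsmul_mem_iff (N := N) hai]
          constructor
          · intro h
            rw [smul_neg] at h
            simpa [sub_eq_add_neg, add_comm] using add_mem h h1
          · intro h
            have := add_mem h h2
            rw [smul_neg] at this ⊢
            rwa [show b.2 i • a - a.2 i • b + -(b.2 i • a) = -(a.2 i • b) by abel] at this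
      · push Not at hz
        have hlo : (θ '' {a ∈ F1 | 0 < a.2 i ∧ a ∈ N}).Finite :=
          (hF1fin.subset fun a ha => ha.1).image θ
        have hhi : (θ '' {a ∈ F1 | 0 < a.2 i ∧ -a ∈ N}).Finite :=
          (hF1fin.subset fun a ha => ha.1).image θ
        obtain ⟨t, ht1, ht2⟩ := Order.exists_between_finsets hlo.toFinset hhi.toFinset (by
          intro u hu v hv
          rw [Set.Finite.mem_toFinset] at hu hv
          obtain ⟨a, ⟨ha, hai, haN⟩, rfl⟩ := hu
          obtain ⟨b, ⟨hb, hbi, hbN⟩, rfl⟩ := hv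
          by_contra! hle
          rw [← key a ha b hb hai hbi] at hle
          have h1 := add_mem hle (TotalCone.zsmul_mem hai.le hbN)
          rw [smul_neg, show a.2 i • b - b.2 i • a + -(a.2 i • b) = b.2 i • (-a) by
            rw [smul_neg]; abel] at h1
          exact hz a ha hai haN (TotalCone.mem_of_zsmul_mem hbi h1))
        refine ⟨t, fun a ha hai => ?_⟩
        rcases N.total a with h | h
        · have h' := hz a ha hai h
          have := ht1 (θ a) (hlo.mem_toFinset.2 ⟨a, ⟨ha, hai, h⟩, rfl⟩)
          simp [h, h', this.le, this]
        · have h' : a ∉ N := fun h' => hz a ha hai h' h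
          have := ht2 (θ a) (hhi.mem_toFinset.2 ⟨a, ⟨ha, hai, h⟩, rfl⟩)
          simp [h, h', this.le, this]
    obtain ⟨t, ht⟩ := main
    refine ⟨x + Pi.single i t, fun a ha => ?_⟩
    rw [termVal_add_single]
    rcases lt_trichotomy (a.2 i) 0 with h | h | h
    · have := (ht (-a) (Or.inr ⟨a, ha, rfl⟩) (by simpa using h)).2
      have h' : (a.2 i : ℝ) < 0 := by exact_mod_cast h
      rw [neg_neg] at this
      rw [this]
      have h2 : θ (-a) = termVal x a / (-(a.2 i : ℝ)) := by simp [θ, termVal_neg]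
      rw [h2, le_div_iff₀ (neg_pos.2 h')]
      constructor <;> intro h <;> linarith
    · rw [hx a (Or.inl ⟨Or.inl ha, h⟩), h]
      simp
    · have h' : (0 : ℝ) < a.2 i := by exact_mod_cast h
      rw [(ht a (Or.inl ha) h).1, div_le_iff₀ h']
      constructor <;> intro h <;> linarith

theorem exists_matching {N : TotalCone n} (hN : ((-1, 0) : Term n) ∉ N) {F : Set (Term n)}
    (hF : F.Finite) : ∃ x : Fin n → ℝ, ∀ a ∈ F, (a ∈ N ↔ 0 ≤ termVal x a) :=
  exists_matching_of_support hN Finset.univ F hF (by simp)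

/-! ### The rank of a total cone -/

/-- `X` contains a neighbourhood of one of its points in an affine space of dimension at
least `k`. -/
def ContainsBall (k : ℕ) (X : Set (Fin n → ℝ)) : Prop :=
  ∃ x : Fin n → ℝ, ∃ W : Submodule ℝ (Fin n → ℝ), k ≤ Module.finrank ℝ W ∧
    ∃ ε > 0, ∀ w ∈ W, ‖w‖ < ε → x + w ∈ X

/-- If the ranks agreed, B / A would be torsion, and saturation would put m into A. -/
theorem finrank_lt_of_saturated {M : Type*} [AddCommGroup M] [Module.Finite ℤ M]
    {A B : Submodule ℤ M} (hAB : A ≤ B) (hsat : ∀ (k : ℤ) (m : M), k ≠ 0 → k • m ∈ A → m ∈ A)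
    {m : M} (hB : m ∈ B) (hA : m ∉ A) : Module.finrank ℤ A < Module.finrank ℤ B := by
  have h1 := Submodule.finrank_quotient_add_finrank (A.submoduleOf B)
  rw [(Submodule.submoduleOfEquivOfLe hAB).finrank_eq] at h1
  by_contra! hle
  have h2 : Module.finrank ℤ (B ⧸ A.submoduleOf B) = 0 := by omega
  rw [Module.finrank_eq_zero_iff_isTorsion] at h2
  obtain ⟨⟨c, hc⟩, hcm⟩ := @h2 (Submodule.Quotient.mk ⟨m, hB⟩)
  rw [Submonoid.mk_smul, ← Submodule.Quotient.mk_smul, Submodule.Quotient.mk_eq_zero] at hcm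
  exact hA (hsat c m (nonZeroDivisors.ne_zero hc) hcm)

/-- The orthogonal complement in `ℝⁿ` of a set of integer vectors. -/
def perp (D : Submodule ℤ (Fin n → ℤ)) : Submodule ℝ (Fin n → ℝ) where
  carrier := {w | ∀ m ∈ D, ∑ i, (m i : ℝ) * w i = 0}
  zero_mem' := by simp
  add_mem' {v w} hv hw m hm := by
    simp only [Pi.add_apply, mul_add, Finset.sum_add_distrib, hv m hm, hw m hm, add_zero]
  smul_mem' c w hw m hm := by
    simp only [Pi.smul_apply, smul_eq_mul, mul_left_comm _ c, ← Finset.mul_sum, hw m hm, mul_zero]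

/-- The complement contains the kernel of the matrix whose rows are a basis of D. -/
theorem le_finrank_perp (D : Submodule ℤ (Fin n → ℤ)) :
    n - Module.finrank ℤ D ≤ Module.finrank ℝ (perp D) := by
  let b := Module.finBasis ℤ D
  let A : Matrix (Fin (Module.finrank ℤ D)) (Fin n) ℝ := fun j i => ((b j : Fin n → ℤ) i : ℝ)
  have hker : LinearMap.ker A.mulVecLin ≤ perp D := by
    intro w hw m hm
    have hw' : ∀ j, ∑ i, ((b j : Fin n → ℤ) i : ℝ) * w i = 0 := fun j => congrFun hw j
    have hsum : m = ∑ j, b.repr ⟨m, hm⟩ j • (b j : Fin n → ℤ) := by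
      have := congrArg Subtype.val (b.sum_repr ⟨m, hm⟩)
      rw [AddSubmonoidClass.coe_finsetSum] at this
      exact this.symm
    rw [hsum]
    simp only [Finset.sum_apply, Pi.smul_apply, smul_eq_mul, Int.cast_sum, Int.cast_mul,
      Finset.sum_mul]
    rw [Finset.sum_comm]
    simp only [mul_assoc, ← Finset.mul_sum, hw', mul_zero, Finset.sum_const_zero]
  have h1 := A.mulVecLin.finrank_range_add_finrank_ker
  have h2 : Module.finrank ℝ (LinearMap.range A.mulVecLin) ≤ Module.finrank ℤ D := by
    simpa using Submodule.finrank_le (LinearMap.range A.mulVecLin)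
  have h3 := Submodule.finrank_mono hker
  simp only [Module.finrank_fintype_fun_eq_card, Fintype.card_fin] at h1
  omega

namespace TotalCone

/-- The exponent vectors of the terms that are equivalent to a constant. -/
def dir (N : TotalCone n) : Submodule ℤ (Fin n → ℤ) where
  carrier := {m | ∃ r : ℝ, (r, m) ∈ N ∧ -((r, m) : Term n) ∈ N}
  zero_mem' := ⟨0, zero_mem N, by
    rw [show ((0, 0) : Term n) = 0 from rfl, neg_zero]; exact zero_mem N⟩
  add_mem' := by
    rintro a b ⟨r, hr, hr'⟩ ⟨s, hs, hs'⟩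
    refine ⟨r + s, add_mem hr hs, ?_⟩
    have := add_mem hr' hs'
    rwa [← neg_add] at this
  smul_mem' := by
    rintro k m ⟨r, hr, hr'⟩
    have key : ∀ k : ℤ, 0 ≤ k → k • ((r, m) : Term n) ∈ N ∧ -(k • ((r, m) : Term n)) ∈ N :=
      fun k hk => ⟨zsmul_mem hk hr, by rw [← smul_neg]; exact zsmul_mem hk hr'⟩
    refine ⟨k • r, ?_⟩
    change k • ((r, m) : Term n) ∈ N ∧ -(k • ((r, m) : Term n)) ∈ N
    rcases le_total 0 k with hk | hk
    · exact key k hk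
    · have := key (-k) (neg_nonneg.2 hk)
      rwa [neg_smul, neg_neg, and_comm] at this

theorem mem_dir {N : TotalCone n} {m : Fin n → ℤ} :
    m ∈ N.dir ↔ ∃ r : ℝ, (r, m) ∈ N ∧ -((r, m) : Term n) ∈ N := Iff.rfl

theorem dir_saturated (N : TotalCone n) (k : ℤ) (m : Fin n → ℤ) (hk : k ≠ 0)
    (h : k • m ∈ N.dir) : m ∈ N.dir := by
  have key : ∀ k : ℤ, 0 < k → k • m ∈ N.dir → m ∈ N.dir := by
    rintro k hk ⟨r, hr, hr'⟩
    have hk' : (k : ℝ) ≠ 0 := by exact_mod_cast hk.ne'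
    have h1 : ((r, k • m) : Term n) = k • (r / k, m) := by
      ext <;> simp [mul_div_cancel₀ _ hk']
    rw [h1] at hr hr'
    rw [← smul_neg] at hr'
    exact ⟨r / k, mem_of_zsmul_mem hk hr, mem_of_zsmul_mem hk hr'⟩
  rcases lt_or_gt_of_ne hk with hk | hk
  · refine key (-k) (neg_pos.2 hk) ?_
    rw [neg_smul]
    exact neg_mem h
  · exact key k hk h

theorem dir_mono {N M : TotalCone n} (h : N ≤ M) : N.dir ≤ M.dir :=
  fun _ ⟨r, hr, hr'⟩ => ⟨r, h hr, h hr'⟩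

theorem real_mem_of_neg_one_mem {N : TotalCone n} (h : ((-1, 0) : Term n) ∈ N) (r : ℝ) :
    ((r, 0) : Term n) ∈ N := by
  obtain ⟨k, hk⟩ := exists_nat_gt (-r)
  have := add_mem (nsmul_mem h k) (N.nonneg (r := r + k) (by linarith))
  convert this using 1
  ext <;> simp

open Classical in
/-- The rank of the lattice of exponents equivalent to constants, increased by one if all
constants are equivalent. -/
def corank (N : TotalCone n) : ℕ :=
  Module.finrank ℤ N.dir + if ((-1, 0) : Term n) ∈ N then 1 else 0

theorem corank_le (N : TotalCone n) : N.corank ≤ n + 1 := by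
  have : Module.finrank ℤ N.dir ≤ n := by simpa using Submodule.finrank_le N.dir
  unfold corank
  split_ifs <;> omega

/-- Otherwise N and M have the same constants and, by saturation, the same `dir`. If a ∈ M and −a ∈
N, then a differs from an element of N by a constant of M, which is also in N; so M ≤ N. -/
theorem corank_lt {N M : TotalCone n} (h : N < M) : N.corank < M.corank := by
  have hle := dir_mono h.le
  have hfin := Submodule.finrank_mono hle
  by_contra! hcon
  unfold corank at hcon
  have hreal : ((-1, 0) : Term n) ∈ M → ((-1, 0) : Term n) ∈ N := by
    intro hM
    by_contra hN
    rw [if_pos hM, if_neg hN] at hcon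
    omega
  have hdir : M.dir ≤ N.dir := by
    intro m hm
    by_contra hmN
    have := finrank_lt_of_saturated hle N.dir_saturated hm hmN
    by_cases h1 : ((-1, 0) : Term n) ∈ N
    · rw [if_pos h1, if_pos (h.le h1)] at hcon
      omega
    · rw [if_neg h1] at hcon
      omega
  refine h.not_ge fun a ha => (N.total a).elim id fun ha' => ?_
  obtain ⟨r, hr, hr'⟩ := hdir (show a.2 ∈ M.dir from ⟨a.1, ha, h.le ha'⟩)
  have hsub : a = (r, a.2) + (a.1 - r, 0) := by ext <;> simp
  have h1 : ((a.1 - r, 0) : Term n) ∈ M := by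
    have := add_mem ha (h.le hr')
    convert this using 1
    ext <;> simp [sub_eq_add_neg]
  rw [hsub]
  refine add_mem hr ?_
  by_cases hM : ((-1, 0) : Term n) ∈ M
  · exact real_mem_of_neg_one_mem (hreal hM) _
  · exact N.nonneg ((real_mem_iff hM).1 h1)

/-- If a cone that is nontrivial on constants defines a congruence above `C`, then the variety of
`C` is at least of dimension `n` minus the rank of the lattice of exponents equivalent to
constants. -/
theorem containsBall_congVariety {N : TotalCone n} (hN : ((-1, 0) : Term n) ∉ N)
    {C : RingCon (Laurent n)} (hC : C ≤ N.cong) (hfin : HasFiniteTropicalBasis C) :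
    ContainsBall (n - Module.finrank ℤ N.dir) (congVariety (pairs C)) := by
  obtain ⟨S, hS, hSC, hV⟩ := hfin
  rw [hV]
  obtain ⟨x, hx⟩ := exists_matching hN (finite_termDiffs hS)
  refine ⟨x, perp N.dir, le_finrank_perp _, ?_⟩
  have hcont : ∀ a : Term n, Continuous fun w : Fin n → ℝ => termVal (x + w) a := fun a => by
    unfold termVal
    fun_prop
  have hev : ∀ᶠ w in nhds (0 : Fin n → ℝ), ∀ a ∈ termDiffs S, 0 < termVal x a →
      0 < termVal (x + w) a := by
    rw [Filter.eventually_all_finite (finite_termDiffs hS)]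
    intro a _
    by_cases h : 0 < termVal x a
    · have := ((hcont a).tendsto 0).eventually_const_lt (u := 0) (by simpa using h)
      filter_upwards [this] with w hw _ using hw
    · exact Filter.Eventually.of_forall fun w h' => absurd h' h
  obtain ⟨ε, hε, hball⟩ := Metric.eventually_nhds_iff.1 hev
  refine ⟨ε, hε, fun w hw hwε => mem_congVariety_iff.2 fun p hp => ?_⟩
  have hp' : N.cong p.1 p.2 := hC (hSC hp)
  refine cong_of_termDiffs (fun d hd hdN => ?_) hp hp'
  rw [mem_pointCone]
  -- If d is equivalent to 0, its exponent lies in `dir` and moving by w does not change its value.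
  -- Otherwise its value at x is strictly positive, and stays so for small w.
  by_cases hneg : -d ∈ N
  · rw [termVal_point_add, hw d.2 ⟨d.1, hdN, hneg⟩, add_zero]
    exact (hx d hd).1 hdN
  · refine (hball (by simpa using hwε) d hd ?_).le
    have := (hx _ (neg_mem_termDiffs hd)).not.1 hneg
    rw [termVal_neg] at this
    linarith

/-! ### Refinement of cones -/

/-- The preorder that compares by `N` first, and then by `M`. -/
def refine (N M : TotalCone n) : TotalCone n where
  carrier := {a | a ∈ N ∧ (-a ∈ N → a ∈ M)}
  zero_mem' := ⟨zero_mem N, fun _ => zero_mem M⟩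
  add_mem' {a b} ha hb := by
    refine ⟨add_mem ha.1 hb.1, fun h => add_mem (ha.2 ?_) (hb.2 ?_)⟩
    · have := add_mem h hb.1
      rwa [neg_add_rev, add_comm (-b), add_assoc, neg_add_cancel, add_zero] at this
    · have := add_mem h ha.1
      rwa [neg_add_rev, add_assoc, neg_add_cancel, add_zero] at this
  total' a := by
    simp only [Set.mem_ofPred_eq, neg_neg]
    rcases N.total a with h | h <;> rcases M.total a with h' | h' <;> tauto
  nonneg' r hr := ⟨N.nonneg hr, fun _ => M.nonneg hr⟩

theorem mem_refine {N M : TotalCone n} {a : Term n} :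
    a ∈ N.refine M ↔ a ∈ N ∧ (-a ∈ N → a ∈ M) := Iff.rfl

theorem refine_le (N M : TotalCone n) : N.refine M ≤ N := fun _ h => h.1

end TotalCone

/-! ### Boolean parts and cones that identify all constants -/

theorem isTerm_boolPart {f : Laurent n} {a : Term n} :
    IsTerm (boolPart f) a ↔ a.1 = 0 ∧ ∃ r, IsTerm f (r, a.2) := by
  have : (boolPart f).coeff a.2 = if a.2 ∈ f.coeff.support then 1 else 0 := by
    rw [boolPart, AddMonoidAlgebra.coeff_sum, Finsupp.finsetSum_apply]
    simp [AddMonoidAlgebra.coeff_single, Finsupp.single_apply]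
  rw [IsTerm, this]
  split_ifs with h
  · rw [← ofReal_zero, ofReal_injective.eq_iff, eq_comm, iff_self_and]
    intro _
    exact exists_isTerm_of_coeff_ne_zero (Finsupp.mem_support_iff.1 h)
  · constructor
    · intro h'
      exact absurd h'.symm (ofReal_ne_zero _)
    · rintro ⟨-, r, hr⟩
      exact absurd hr.mem_support h

/-- Modulo such a cone only exponents count, and `boolPart` does not change them. -/
theorem TotalCone.dom_boolPart_iff {N : TotalCone n} (hN : ((-1, 0) : Term n) ∈ N)
    {f g : Laurent n} : N.dom (boolPart f) (boolPart g) ↔ N.dom f g := by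
  have key : ∀ a b : Term n, a.2 = b.2 → a ∈ N → b ∈ N := fun a b h ha => by
    have := add_mem ha (real_mem_of_neg_one_mem hN (b.1 - a.1))
    convert this using 1
    ext <;> simp [h]
  constructor
  · intro h a ha
    obtain ⟨b, hb, hab⟩ := h (0, a.2) (isTerm_boolPart.2 ⟨rfl, a.1, ha⟩)
    obtain ⟨-, r, hr⟩ := isTerm_boolPart.1 hb
    exact ⟨(r, b.2), hr, key (b - (0, a.2)) _ rfl hab⟩
  · intro h a ha
    obtain ⟨ha1, r, hr⟩ := isTerm_boolPart.1 ha
    obtain ⟨b, hb, hab⟩ := h _ hr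
    exact ⟨(0, b.2), isTerm_boolPart.2 ⟨rfl, b.1, hb⟩, key (b - (r, a.2)) _ rfl hab⟩

/-- Comparing coefficients first and using N only for ties gives a cone that separates constants. It
has the same `dir`, and it agrees with N on differences of terms of Boolean parts, so
`containsBall_congVariety` applies to C_B. -/
theorem TotalCone.containsBall_congVariety_boolCong {N : TotalCone n}
    (hN : ((-1, 0) : Term n) ∈ N) {C : RingCon (Laurent n)} (hC : C ≤ N.cong)
    (hfin : HasFiniteTropicalBasis (boolCong C)) :
    ContainsBall (n - Module.finrank ℤ N.dir) (congVariety (pairs (boolCong C))) := by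
  let R : TotalCone n :=
    { carrier := {a | 0 ≤ a.1}
      zero_mem' := le_refl (0 : ℝ)
      add_mem' := fun {a b} (ha : 0 ≤ a.1) (hb : 0 ≤ b.1) =>
        show 0 ≤ a.1 + b.1 from add_nonneg ha hb
      total' := fun a => by simpa using le_total 0 a.1
      nonneg' := fun _ hr => hr }
  have hmem : ∀ a : Term n, a ∈ R.refine N ↔ 0 ≤ a.1 ∧ (0 ≤ -a.1 → a ∈ N) := fun a => Iff.rfl
  have hR : ((-1, 0) : Term n) ∉ R.refine N := fun h => by
    have := h.1
    change (0 : ℝ) ≤ -1 at this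
    linarith
  have hbool : boolCong C ≤ (R.refine N).cong := by
    have key : ∀ f g, N.dom f g → (R.refine N).dom (boolPart f) (boolPart g) := by
      intro f g hfg a ha
      obtain ⟨b, hb, hab⟩ := (dom_boolPart_iff hN).2 hfg a ha
      have h1 := (isTerm_boolPart.1 ha).1
      have h2 := (isTerm_boolPart.1 hb).1
      exact ⟨b, hb, (hmem _).2 ⟨by simp [h1, h2], fun _ => hab⟩⟩
    refine RingCon.ringConGen_le.2 ?_
    rintro p q ⟨f, g, hfg, rfl, rfl⟩
    exact ⟨key _ _ (hC hfg).1, key _ _ (hC hfg).2⟩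
  have hdir : (R.refine N).dir = N.dir := by
    ext m
    simp only [mem_dir, hmem, Prod.fst_neg, neg_neg]
    constructor
    · rintro ⟨r, h1, h2⟩
      exact ⟨r, h1.2 h2.1, h2.2 h1.1⟩
    · rintro ⟨r, h1, h2⟩
      refine ⟨0, ⟨le_rfl, fun _ => ?_⟩, ⟨by simp, fun _ => ?_⟩⟩
      · have := add_mem h1 (real_mem_of_neg_one_mem hN (-r))
        convert this using 1
        ext <;> simp
      · have := add_mem h2 (real_mem_of_neg_one_mem hN r)
        convert this using 1
        ext <;> simp
  rw [← hdir]
  exact containsBall_congVariety hR hbool hfin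

/-! ### Dimensions of polyhedral complexes -/

theorem IsPolyhedralSet.convex {P : Set (Fin n → ℝ)} (hP : IsPolyhedralSet P) : Convex ℝ P := by
  obtain ⟨l, A, b, rfl⟩ := hP
  exact (convex_Ici b).linear_preimage A.mulVecLin

/-- The ball is taken around a point of the intrinsic interior. -/
theorem containsBall_of_convex {P X : Set (Fin n → ℝ)} (hP : Convex ℝ P) (hne : P.Nonempty)
    (hPX : P ⊆ X) : ContainsBall (Module.finrank ℝ (affineSpan ℝ P).direction) X := by
  obtain ⟨_, x, hx, rfl⟩ := hne.intrinsicInterior hP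
  obtain ⟨ε, hε, hball⟩ := Metric.mem_nhds_iff.1 (mem_interior_iff_mem_nhds.1 hx)
  refine ⟨x, (affineSpan ℝ P).direction, le_rfl, ε, hε, fun w hw hwε => hPX ?_⟩
  have hmem : (x : Fin n → ℝ) + w ∈ affineSpan ℝ P := by
    rw [add_comm]
    exact AffineSubspace.vadd_mem_of_mem_direction hw x.2
  have : (⟨x + w, hmem⟩ : affineSpan ℝ P) ∈ Metric.ball x ε := by
    rw [Metric.mem_ball, Subtype.dist_eq, dist_eq_norm]
    simpa using hwε
  exact hball this

/-- Proper affine subspaces have Haar measure zero, a ball does not. -/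
theorem exists_eq_top_of_ball_subset {E : Type*} [NormedAddCommGroup E] [NormedSpace ℝ E]
    [FiniteDimensional ℝ E] {ι : Type*} {s : Set ι} (hs : s.Finite) (A : ι → AffineSubspace ℝ E)
    {x : E} {ε : ℝ} (hε : 0 < ε) (h : Metric.ball x ε ⊆ ⋃ i ∈ s, (A i : Set E)) :
    ∃ i ∈ s, A i = ⊤ := by
  let _ : MeasurableSpace E := borel E
  have _ : BorelSpace E := ⟨rfl⟩
  by_contra! hcon
  have h1 : (MeasureTheory.Measure.addHaar : MeasureTheory.Measure E)
      (⋃ i ∈ s, (A i : Set E)) = 0 :=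
    (MeasureTheory.measure_biUnion_null_iff hs.countable).2 fun i hi =>
      MeasureTheory.Measure.addHaar_affineSubspace _ _ (hcon i hi)
  exact (Metric.measure_ball_pos _ x hε).ne' (MeasureTheory.measure_mono_null h h1)

namespace PolyhedralComplex

theorem containsBall_support (K : PolyhedralComplex n) {P : Set (Fin n → ℝ)} (hP : P ∈ K.cells)
    (hne : P.Nonempty) :
    ContainsBall (Module.finrank ℝ (affineSpan ℝ P).direction) K.support :=
  containsBall_of_convex (K.polyhedral P hP).convex hne (Set.subset_sUnion_of_mem hP)

/-- Pulled back to W, the affine hulls of the finitely many cells cover a ball, so one of them is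
everything; the hull of that cell contains x + W. -/
theorem le_dim_of_containsBall (K : PolyhedralComplex n) {k : ℕ}
    (h : ContainsBall k K.support) : (k : WithBot ℕ∞) ≤ K.dim := by
  obtain ⟨x, W, hk, ε, hε, hball⟩ := h
  let φ : W →ᵃ[ℝ] (Fin n → ℝ) := AffineMap.const ℝ W x + W.subtype.toAffineMap
  have hφ : ∀ w : W, φ w = x + w := fun w => rfl
  obtain ⟨P, hP, htop⟩ := exists_eq_top_of_ball_subset K.finite_cells
    (fun P => (affineSpan ℝ P).comap φ) (x := 0) hε (by
      intro w hw
      obtain ⟨P, hP, hwP⟩ := hball w w.2 (by simpa using hw)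
      exact Set.mem_biUnion hP (subset_affineSpan ℝ P hwP))
  have hmem : ∀ w : W, x + w ∈ affineSpan ℝ P := fun w => by
    have : w ∈ (affineSpan ℝ P).comap φ := by rw [htop]; trivial
    exact this
  have hne : P.Nonempty := (affineSpan_nonempty ℝ).1 ⟨_, hmem 0⟩
  have hW : W ≤ (affineSpan ℝ P).direction := by
    intro w hw
    have := AffineSubspace.vsub_mem_direction (hmem ⟨w, hw⟩) (hmem 0)
    simpa using this
  calc (k : WithBot ℕ∞) ≤ polyhedralSetDim P := by
        rw [polyhedralSetDim, if_pos hne]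
        exact_mod_cast hk.trans (Submodule.finrank_mono hW)
    _ ≤ K.dim := le_iSup₂ (f := fun P (_ : P ∈ K.cells) => polyhedralSetDim P) P hP

theorem dim_le_of_support_subset {K K' : PolyhedralComplex n} (h : K.support ⊆ K'.support) :
    K.dim ≤ K'.dim := by
  refine iSup₂_le fun P hP => ?_
  rw [polyhedralSetDim]
  split_ifs with hne
  · refine K'.le_dim_of_containsBall ?_
    obtain ⟨x, W, hk, ε, hε, hball⟩ := K.containsBall_support hP hne
    exact ⟨x, W, hk, ε, hε, fun w hw hwε => h (hball w hw hwε)⟩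
  · exact bot_le

theorem dim_eq_bot_or (K : PolyhedralComplex n) :
    K.dim = ⊥ ∨ ∃ k : ℕ, K.dim = k ∧ ContainsBall k K.support := by
  by_cases h : K.dim = ⊥
  · exact Or.inl h
  right
  have hne : K.cells.Nonempty := by
    by_contra hcon
    rw [Set.not_nonempty_iff_eq_empty] at hcon
    exact h (by simp [dim, hcon])
  obtain ⟨P, hP, hmax⟩ := Set.exists_max_image K.cells polyhedralSetDim K.finite_cells hne
  have hdim : K.dim = polyhedralSetDim P :=
    le_antisymm (iSup₂_le hmax)
      (le_iSup₂ (f := fun P (_ : P ∈ K.cells) => polyhedralSetDim P) P hP)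
  by_cases hPne : P.Nonempty
  · refine ⟨_, ?_, K.containsBall_support hP hPne⟩
    rw [hdim, polyhedralSetDim, if_pos hPne]
  · rw [polyhedralSetDim, if_neg hPne] at hdim
    exact absurd hdim h

end PolyhedralComplex

/-! ### The variety of a finite set of pairs is the support of a polyhedral complex -/

theorem termVal_lineMap (x y : Fin n → ℝ) (t : ℝ) (a : Term n) :
    termVal (x + t • (y - x)) a = termVal x a + t * (termVal y a - termVal x a) := by
  rw [termVal_point_add]
  simp only [termVal, Pi.smul_apply, Pi.sub_apply, smul_eq_mul, add_right_inj, add_sub_add_left_eq_sub,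
    ← Finset.sum_sub_distrib, Finset.mul_sum]
  exact Finset.sum_congr rfl fun i _ => by ring

/-- The closed cell of the point `y` in the arrangement of the hyperplanes given by `D`. -/
def signCell (D : Set (Term n)) (y : Fin n → ℝ) : Set (Fin n → ℝ) :=
  {x | ∀ d ∈ D, 0 ≤ termVal y d → 0 ≤ termVal x d}

section SignCell

variable {D : Set (Term n)} {x y z : Fin n → ℝ}

theorem self_mem_signCell : y ∈ signCell D y := fun _ _ h => h

theorem signCell_subset (h : z ∈ signCell D y) : signCell D z ⊆ signCell D y :=
  fun _ hx d hd hy => hx d hd (h d hd hy)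

theorem convex_signCell : Convex ℝ (signCell D y) := by
  intro u hu v hv s t hs ht hst d hd hy
  have h1 : s • u + t • v = u + t • (v - u) := by
    rw [← eq_sub_iff_add_eq] at hst
    rw [hst]
    module
  have h2 := hu d hd hy
  have h3 := hv d hd hy
  rw [h1, termVal_lineMap]
  have : termVal u d + t * (termVal v d - termVal u d) = s * termVal u d + t * termVal v d := by
    rw [← eq_sub_iff_add_eq] at hst
    rw [hst]
    ring
  rw [this]
  positivity

theorem isPolyhedralSet_signCell (hD : D.Finite) : IsPolyhedralSet (signCell D y) := by
  have hD' : {d ∈ D | 0 ≤ termVal y d}.Finite := hD.subset fun d hd => hd.1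
  obtain ⟨l, f, hf⟩ := hD'.fin_param
  refine ⟨l, fun j i => ((f j).2 i : ℝ), fun j => -(f j).1, ?_⟩
  have hval : ∀ (x : Fin n → ℝ) (j : Fin l), -(f j).1 ≤ ((fun j i => ((f j).2 i : ℝ)) *ᵥ x) j ↔
      0 ≤ termVal x (f j) := fun x j => neg_le_iff_add_nonneg'
  ext x
  constructor
  · intro hx j
    have hj : f j ∈ {d ∈ D | 0 ≤ termVal y d} := hf.2 ▸ Set.mem_range_self j
    exact (hval x j).2 (hx _ hj.1 hj.2)
  · intro hx d hd hy
    have hd' : d ∈ Set.range f := hf.2 ▸ ⟨hd, hy⟩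
    obtain ⟨j, rfl⟩ := hd'
    exact (hval x j).1 (hx j)

theorem finite_range_signCell (hD : D.Finite) : (Set.range (signCell D)).Finite := by
  refine (hD.finite_subsets.image fun A => {x | ∀ d ∈ A, 0 ≤ termVal x d}).subset ?_
  rintro _ ⟨y, rfl⟩
  refine ⟨{d ∈ D | 0 ≤ termVal y d}, fun d hd => hd.1, ?_⟩
  ext x
  exact ⟨fun h d hd hy => h d ⟨hd, hy⟩, fun h d hd => h d hd.1 hd.2⟩

/-- A convex set on which finitely many affine functions are nonnegative has a point at which only
those vanish that vanish identically. -/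
theorem exists_generic_point {F : Set (Fin n → ℝ)} (hF : Convex ℝ F) (hne : F.Nonempty)
    {A : Set (Term n)} (hA : A.Finite) (hnn : ∀ d ∈ A, ∀ x ∈ F, 0 ≤ termVal x d) :
    ∃ z ∈ F, ∀ d ∈ A, termVal z d = 0 → ∀ x ∈ F, termVal x d = 0 := by
  induction A, hA using Set.Finite.induction_on with
  | empty =>
    obtain ⟨z, hz⟩ := hne
    exact ⟨z, hz, by simp⟩
  | @insert d A _ _ ih =>
    obtain ⟨z, hz, hzA⟩ := ih fun d hd => hnn d (Or.inr hd)
    by_cases h : ∀ x ∈ F, termVal x d = 0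
    · refine ⟨z, hz, ?_⟩
      rintro d' (rfl | hd') h0
      · exact h
      · exact hzA d' hd' h0
    · push Not at h
      obtain ⟨x, hx, hxd⟩ := h
      refine ⟨z + (1 / 2 : ℝ) • (x - z), hF.add_smul_sub_mem hz hx (by norm_num), ?_⟩
      intro d' hd' h0
      have h1 := hnn d' hd' z hz
      have h2 := hnn d' hd' x hx
      rw [termVal_lineMap] at h0
      rcases hd' with rfl | hd'
      · exact absurd (by linarith) hxd
      · exact hzA d' hd' (by linarith)

theorem termVal_eq_zero_of_mem_signCell (hneg : ∀ d ∈ D, -d ∈ D) (hx : x ∈ signCell D z)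
    {d : Term n} (hd : d ∈ D) (hz : termVal z d = 0) : termVal x d = 0 := by
  have h1 := hx d hd hz.ge
  have h2 := hx (-d) (hneg d hd) (by rw [termVal_neg, hz, neg_zero])
  rw [termVal_neg] at h2
  linarith

/-- A generic point z of the face does it. For u in the cell of z, the segment from u to z can be
prolonged slightly beyond z inside the cell of y; since w is minimal at z, its value at u cannot be
larger. -/
theorem exists_eq_signCell_of_isFace (hD : D.Finite) (hneg : ∀ d ∈ D, -d ∈ D)
    {F : Set (Fin n → ℝ)} (hF : IsFace F (signCell D y)) :
    ∃ z ∈ signCell D y, F = signCell D z := by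
  obtain ⟨hne, w, hFw⟩ := hF
  have hFy : F ⊆ signCell D y := fun x hx => by
    rw [hFw] at hx
    exact hx.1
  have hconv : Convex ℝ F := by
    rw [hFw]
    intro u hu v hv s t hs ht hst
    refine ⟨convex_signCell hu.1 hv.1 hs ht hst, fun p hp => ?_⟩
    rw [dotProduct_add, dotProduct_smul, dotProduct_smul, smul_eq_mul, smul_eq_mul]
    calc s * w ⬝ᵥ u + t * w ⬝ᵥ v ≤ s * w ⬝ᵥ p + t * w ⬝ᵥ p :=
          add_le_add (mul_le_mul_of_nonneg_left (hu.2 p hp) hs)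
            (mul_le_mul_of_nonneg_left (hv.2 p hp) ht)
      _ = w ⬝ᵥ p := by rw [← add_mul, hst, one_mul]
  obtain ⟨z, hz, hgen⟩ := exists_generic_point hconv hne
    (A := {d ∈ D | 0 ≤ termVal y d}) (hD.subset fun d hd => hd.1)
    (fun d hd x hx => hFy hx d hd.1 hd.2)
  refine ⟨z, hFy hz, Set.Subset.antisymm (fun x hx d hd hzd => ?_) fun u hu => ?_⟩
  · rcases le_total 0 (termVal y d) with h | h
    · exact hFy hx d hd h
    · have h1 : 0 ≤ termVal y (-d) := by rw [termVal_neg]; linarith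
      have h2 := hFy hz (-d) (hneg d hd) h1
      rw [termVal_neg] at h2
      have h3 := hgen (-d) ⟨hneg d hd, h1⟩ (by rw [termVal_neg]; linarith) x hx
      rw [termVal_neg] at h3
      linarith
  · have hz' := hz
    rw [hFw] at hz' ⊢
    have huy := signCell_subset (hFy hz) hu
    refine ⟨huy, fun p hp => le_trans ?_ (hz'.2 p hp)⟩
    have hev : ∀ᶠ t in nhds (0 : ℝ), ∀ d ∈ D, 0 < termVal z d →
        0 < termVal (z + t • (u - z)) d := by
      rw [Filter.eventually_all_finite hD]
      intro d _
      by_cases h : 0 < termVal z d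
      · have hcont : Continuous fun t : ℝ => termVal (z + t • (u - z)) d := by
          unfold termVal
          fun_prop
        have := (hcont.tendsto 0).eventually_const_lt (u := 0) (by simpa using h)
        filter_upwards [this] with t ht _ using ht
      · exact Filter.Eventually.of_forall fun t h' => absurd h' h
    obtain ⟨ε, hε, hball⟩ := Metric.eventually_nhds_iff.1 hev
    have hq : z + (-(ε / 2)) • (u - z) ∈ signCell D y := by
      intro d hd hyd
      rcases (hFy hz d hd hyd).lt_or_eq with h | h
      · refine (hball ?_ d hd h).le
        rw [Real.dist_eq, sub_zero, abs_neg, abs_of_pos (by linarith)]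
        linarith
      · rw [termVal_lineMap, ← h, termVal_eq_zero_of_mem_signCell hneg hu hd h.symm]
        simp
    have := hz'.2 _ hq
    rw [dotProduct_add, dotProduct_smul, dotProduct_sub, smul_eq_mul] at this
    nlinarith

/-- Up to a constant, the functional is the sum of all d in D that are nonnegative on the first cell
and nonpositive on the second. On the first cell it is minimal exactly where all these d vanish. -/
theorem isFace_inter_signCell (hD : D.Finite) (hneg : ∀ d ∈ D, -d ∈ D)
    (hne : (signCell D y ∩ signCell D z).Nonempty) :
    IsFace (signCell D y ∩ signCell D z) (signCell D y) := by
  have hA : {d ∈ D | 0 ≤ termVal y d ∧ 0 ≤ termVal z (-d)}.Finite := hD.subset fun d hd => hd.1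
  set A := hA.toFinset
  have hAmem : ∀ d, d ∈ A ↔ d ∈ D ∧ 0 ≤ termVal y d ∧ 0 ≤ termVal z (-d) := fun d =>
    hA.mem_toFinset
  refine ⟨hne, fun i => ∑ d ∈ A, (d.2 i : ℝ), ?_⟩
  have hval : ∀ x : Fin n → ℝ, ((fun i => ∑ d ∈ A, (d.2 i : ℝ)) ⬝ᵥ x) =
      ∑ d ∈ A, termVal x d - ∑ d ∈ A, d.1 := by
    intro x
    simp only [dotProduct, termVal, Finset.sum_add_distrib, add_sub_cancel_left, Finset.sum_mul]
    exact Finset.sum_comm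
  have hnn : ∀ x ∈ signCell D y, ∀ d ∈ A, 0 ≤ termVal x d := fun x hx d hd =>
    hx d ((hAmem d).1 hd).1 ((hAmem d).1 hd).2.1
  have hzero : ∀ x ∈ signCell D y ∩ signCell D z, ∑ d ∈ A, termVal x d = 0 := by
    intro x hx
    refine Finset.sum_eq_zero fun d hd => le_antisymm ?_ (hnn x hx.1 d hd)
    have := hx.2 (-d) (hneg d ((hAmem d).1 hd).1) ((hAmem d).1 hd).2.2
    rw [termVal_neg] at this
    linarith
  simp only [hval, sub_le_sub_iff_right]
  ext x
  constructor
  · intro hx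
    refine ⟨hx.1, fun p hp => ?_⟩
    rw [hzero x hx]
    exact Finset.sum_nonneg (hnn p hp)
  · rintro ⟨hx, hmin⟩
    refine ⟨hx, fun d hd hzd => ?_⟩
    obtain ⟨p, hp⟩ := hne
    have h1 := hmin p hp.1
    rw [hzero p hp] at h1
    have h2 := (Finset.sum_eq_zero_iff_of_nonneg (hnn x hx)).1
      (le_antisymm h1 (Finset.sum_nonneg (hnn x hx)))
    rcases le_total 0 (termVal y d) with h | h
    · exact hx d hd h
    · have h3 := h2 (-d) ((hAmem _).2 ⟨hneg d hd, by rw [termVal_neg]; linarith, by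
        rwa [neg_neg]⟩)
      rw [termVal_neg] at h3
      linarith

end SignCell

theorem signCell_termDiffs_subset {S : Set (Laurent n × Laurent n)} {y : Fin n → ℝ}
    (hy : y ∈ congVariety S) : signCell (termDiffs S) y ⊆ congVariety S := by
  intro x hx
  rw [mem_congVariety_iff] at hy ⊢
  exact fun p hp => TotalCone.cong_of_termDiffs (N := pointCone y)
    (M := pointCone x) hx hp (hy p hp)

/-- The cells of the arrangement of hyperplanes on which two terms agree, as far as they are
contained in the congruence variety. -/
def varietyComplex {S : Set (Laurent n × Laurent n)} (hS : S.Finite) : PolyhedralComplex n where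
  cells := signCell (termDiffs S) '' congVariety S
  finite_cells := (finite_range_signCell (finite_termDiffs hS)).subset (Set.image_subset_range _ _)
  polyhedral := by
    rintro _ ⟨y, -, rfl⟩
    exact isPolyhedralSet_signCell (finite_termDiffs hS)
  face_mem := by
    rintro _ ⟨y, hy, rfl⟩ F hF
    obtain ⟨z, hz, rfl⟩ := exists_eq_signCell_of_isFace (finite_termDiffs hS)
      (fun _ => neg_mem_termDiffs) hF
    exact ⟨z, signCell_termDiffs_subset hy hz, rfl⟩
  inter_face := by
    rintro _ ⟨y, -, rfl⟩ _ ⟨z, -, rfl⟩ hne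
    refine ⟨isFace_inter_signCell (finite_termDiffs hS) (fun _ => neg_mem_termDiffs) hne, ?_⟩
    rw [Set.inter_comm] at hne ⊢
    exact isFace_inter_signCell (finite_termDiffs hS) (fun _ => neg_mem_termDiffs) hne

theorem support_varietyComplex {S : Set (Laurent n × Laurent n)} (hS : S.Finite) :
    (varietyComplex hS).support = congVariety S := by
  refine Set.Subset.antisymm (Set.sUnion_subset ?_) fun y hy => ?_
  · rintro _ ⟨y, hy, rfl⟩
    exact signCell_termDiffs_subset hy
  · exact Set.mem_sUnion_of_mem self_mem_signCell ⟨y, hy, rfl⟩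

theorem exists_complex {C : RingCon (Laurent n)} (hC : HasFiniteTropicalBasis C) :
    ∃ K : PolyhedralComplex n, K.support = congVariety (pairs C) := by
  obtain ⟨S, hS, -, hV⟩ := hC
  exact ⟨varietyComplex hS, (support_varietyComplex hS).trans hV.symm⟩

theorem hasPolyhedralDim_dim {K : PolyhedralComplex n} {X : Set (Fin n → ℝ)}
    (hK : K.support = X) : HasPolyhedralDim X K.dim :=
  ⟨⟨K, hK⟩, fun _ hK' => le_antisymm
    (PolyhedralComplex.dim_le_of_support_subset (hK'.trans hK.symm).subset)
    (PolyhedralComplex.dim_le_of_support_subset (hK.trans hK'.symm).subset)⟩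

/-! ### Flags of cones -/

/-- The pairing of an integer exponent vector with vectors in `ℝⁿ`. -/
def pairing (m : Fin n → ℤ) : (Fin n → ℝ) →ₗ[ℝ] ℝ := ∑ i, (m i : ℝ) • LinearMap.proj i

theorem pairing_apply (m : Fin n → ℤ) (v : Fin n → ℝ) :
    pairing m v = ∑ i, (m i : ℝ) * v i := by
  simp [pairing]

theorem pairing_add (m m' : Fin n → ℤ) (v : Fin n → ℝ) :
    pairing (m + m') v = pairing m v + pairing m' v := by
  simp [pairing_apply, add_mul, Finset.sum_add_distrib]

theorem pairing_zsmul (k : ℤ) (m : Fin n → ℤ) (v : Fin n → ℝ) :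
    pairing (k • m) v = k * pairing m v := by
  simp [pairing_apply, mul_assoc, Finset.mul_sum]

theorem pairing_neg (m : Fin n → ℤ) (v : Fin n → ℝ) : pairing (-m) v = -pairing m v := by
  simp [pairing_apply]

theorem pairing_zero_left (v : Fin n → ℝ) : pairing 0 v = 0 := by
  simp [pairing_apply]

theorem pairing_single (i : Fin n) (v : Fin n → ℝ) : pairing (Pi.single i 1) v = v i := by
  simp [pairing_apply, Pi.single_apply]

theorem termVal_eq (x : Fin n → ℝ) (a : Term n) : termVal x a = a.1 + pairing a.2 x := by
  rw [pairing_apply, termVal]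

theorem termVal_point_add' (x w : Fin n → ℝ) (a : Term n) :
    termVal (x + w) a = termVal x a + pairing a.2 w := by
  rw [pairing_apply, termVal_point_add]

/-- The cone of terms whose exponent is nonnegative in the direction `v`. -/
def dirCone (v : Fin n → ℝ) : TotalCone n where
  carrier := {a | 0 ≤ pairing a.2 v}
  zero_mem' := (pairing_zero_left v).ge
  add_mem' {a b} ha hb := by
    change 0 ≤ pairing (a.2 + b.2) v
    rw [pairing_add]
    exact add_nonneg ha hb
  total' a := by
    change 0 ≤ pairing a.2 v ∨ 0 ≤ pairing (-a.2) v
    rw [pairing_neg, Left.nonneg_neg_iff]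
    exact le_total _ _
  nonneg' r _ := (pairing_zero_left v).ge

theorem mem_dirCone {v : Fin n → ℝ} {a : Term n} : a ∈ dirCone v ↔ 0 ≤ pairing a.2 v := Iff.rfl

namespace TotalCone

/-- All terms are equivalent here, but the congruence still separates 0 from the nonzero
polynomials. So it is prime and can be the last member of a chain. -/
instance : Top (TotalCone n) :=
  ⟨{ (⊤ : AddSubmonoid (Term n)) with
      total' := fun _ => Or.inl trivial
      nonneg' := fun _ _ => trivial }⟩

theorem mem_top (a : Term n) : a ∈ (⊤ : TotalCone n) := trivial

/-- The preorder comparing lexicographically by `M 0, …, M (i - 1)`. -/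
def flag (M : ℕ → TotalCone n) : ℕ → TotalCone n
  | 0 => ⊤
  | i + 1 => (flag M i).refine (M i)

variable {M : ℕ → TotalCone n}

theorem mem_flag {i : ℕ} {a : Term n} (h : ∀ j < i, a ∈ M j) : a ∈ flag M i := by
  induction i with
  | zero => exact mem_top a
  | succ i ih => exact ⟨ih fun j hj => h j (by omega), fun _ => h i (by omega)⟩

/-- The witness a is equivalent to 0 in the first i comparisons and negative in the next one. -/
theorem flag_succ_lt {i : ℕ} {a : Term n} (h : ∀ j < i, a ∈ M j ∧ -a ∈ M j) (hi : a ∉ M i) :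
    flag M (i + 1) < flag M i := by
  refine lt_of_le_of_ne (refine_le _ _) fun heq => hi ?_
  have h1 : a ∈ flag M (i + 1) := by
    rw [heq]
    exact mem_flag fun j hj => (h j hj).1
  exact h1.2 (mem_flag fun j hj => (h j hj).2)

/-- On finite subsets of `B`, the cone `N` is the cone of a point of `x + W` close to `x`. -/
def Approximable (B : Set (Term n)) (W : Submodule ℝ (Fin n → ℝ)) (x : Fin n → ℝ)
    (N : TotalCone n) : Prop :=
  ∀ F : Set (Term n), F.Finite → F ⊆ B → (∀ d ∈ F, -d ∈ F) → ∀ ε > 0,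
    ∃ w ∈ W, ‖w‖ < ε ∧ ∀ d ∈ F, (d ∈ N ↔ 0 ≤ termVal (x + w) d)

/-- From x + w one moves slightly along v: strict signs persist, and where the value is 0 the
pairing with v decides. -/
theorem Approximable.refine {B : Set (Term n)} {W : Submodule ℝ (Fin n → ℝ)} {x v : Fin n → ℝ}
    {N : TotalCone n} (h : Approximable B W x N) (hv : v ∈ W) :
    Approximable B W x (N.refine (dirCone v)) := by
  intro F hF hFB hneg ε hε
  obtain ⟨w, hw, hwε, hwF⟩ := h F hF hFB hneg (ε / 2) (by linarith)
  have hev : ∀ᶠ t in nhds (0 : ℝ), ‖t • v‖ < ε / 2 ∧ ∀ d ∈ F, 0 < termVal (x + w) d →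
      0 < termVal (x + w) d + t * pairing d.2 v := by
    refine Filter.Eventually.and ?_ ?_
    · have hcont : Continuous fun t : ℝ => ‖t • v‖ := by fun_prop
      exact (hcont.tendsto 0).eventually_lt_const (by simpa using hε)
    · rw [Filter.eventually_all_finite hF]
      intro d _
      by_cases h : 0 < termVal (x + w) d
      · have hcont : Continuous fun t : ℝ => termVal (x + w) d + t * pairing d.2 v := by fun_prop
        have := (hcont.tendsto 0).eventually_const_lt (u := 0) (by simpa using h)
        filter_upwards [this] with t ht _ using ht
      · exact Filter.Eventually.of_forall fun t h' => absurd h' h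
  obtain ⟨δ, hδ, hball⟩ := Metric.eventually_nhds_iff.1 hev
  obtain ⟨hnorm, hpos⟩ := @hball (δ / 2) (by
    rw [Real.dist_eq, sub_zero, abs_of_pos (by linarith)]
    linarith)
  refine ⟨w + (δ / 2) • v, W.add_mem hw (W.smul_mem _ hv), ?_, fun d hd => ?_⟩
  · calc ‖w + (δ / 2) • v‖ ≤ ‖w‖ + ‖(δ / 2) • v‖ := norm_add_le _ _
      _ < ε := by linarith
  · rw [mem_refine, hwF d hd, hwF _ (hneg d hd), termVal_neg, ← add_assoc, termVal_point_add' (x + w),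
      map_smul, smul_eq_mul, mem_dirCone]
    rcases lt_trichotomy (termVal (x + w) d) 0 with h0 | h0 | h0
    · have h1 := hpos _ (hneg d hd) (by rw [termVal_neg]; linarith)
      rw [termVal_neg, Prod.snd_neg, pairing_neg] at h1
      constructor
      · intro h2
        linarith [h2.1]
      · intro h2
        linarith
    · rw [h0, zero_add, mul_nonneg_iff_of_pos_left (by linarith)]
      simp
    · have h1 := hpos d hd h0
      constructor
      · intro _
        exact h1.le
      · intro _
        exact ⟨h0.le, fun h2 => by linarith⟩

theorem approximable_flag {B : Set (Term n)} {W : Submodule ℝ (Fin n → ℝ)} {x : Fin n → ℝ}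
    {v : ℕ → Fin n → ℝ} (h0 : ∀ d ∈ B, d ∈ M 0 ↔ 0 ≤ termVal x d)
    (hM : ∀ i, M (i + 1) = dirCone (v i)) (hv : ∀ i, v i ∈ W) (i : ℕ) :
    Approximable B W x (flag M (i + 1)) := by
  induction i with
  | zero =>
    intro F _ hFB _ ε hε
    refine ⟨0, W.zero_mem, by simpa using hε, fun d hd => ?_⟩
    rw [add_zero, ← h0 d (hFB hd)]
    exact ⟨fun h => h.2 (mem_top _), fun h => ⟨mem_top _, fun _ => h⟩⟩
  | succ i ih =>
    rw [flag, hM]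
    exact ih.refine (hv i)

/-- A single pair of C involves finitely many term differences, so N treats it like a point of the
ball. -/
theorem le_cong_of_approximable {W : Submodule ℝ (Fin n → ℝ)} {x : Fin n → ℝ} {N : TotalCone n}
    (h : Approximable Set.univ W x N) {C : RingCon (Laurent n)} {ε : ℝ} (hε : 0 < ε)
    (hball : ∀ w ∈ W, ‖w‖ < ε → x + w ∈ congVariety (pairs C)) : C ≤ N.cong := by
  intro f g hfg
  obtain ⟨w, hw, hwε, hF⟩ := h (termDiffs {(f, g)}) (finite_termDiffs (Set.finite_singleton _))
    (Set.subset_univ _) (fun _ => neg_mem_termDiffs) ε hε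
  have h1 := mem_congVariety_iff.1 (hball w hw hwε) (f, g) hfg
  exact cong_of_termDiffs (fun d hd h => (hF d hd).2 h) (Set.mem_singleton (f, g)) h1

theorem le_cong_of_approximable_boolCong {W : Submodule ℝ (Fin n → ℝ)} {x : Fin n → ℝ}
    {N : TotalCone n} (hN : ((-1, 0) : Term n) ∈ N) (h : Approximable {a | a.1 = 0} W x N)
    {C : RingCon (Laurent n)} {ε : ℝ} (hε : 0 < ε)
    (hball : ∀ w ∈ W, ‖w‖ < ε → x + w ∈ congVariety (pairs (boolCong C))) : C ≤ N.cong := by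
  intro f g hfg
  obtain ⟨w, hw, hwε, hF⟩ := h (termDiffs {(boolPart f, boolPart g)})
    (finite_termDiffs (Set.finite_singleton _)) (by
      rintro d ⟨p, rfl, a, b, ha, hb, rfl⟩
      simp only [isTerm_boolPart] at ha hb
      have ha1 : a.1 = 0 := by tauto
      have hb1 : b.1 = 0 := by tauto
      simp [ha1, hb1]) (fun _ => neg_mem_termDiffs) ε hε
  have h1 := mem_congVariety_iff.1 (hball w hw hwε) (boolPart f, boolPart g)
    (RingCon.le_ringConGen _ _ ⟨f, g, hfg, rfl, rfl⟩)
  have h2 : N.cong (boolPart f) (boolPart g) :=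
    cong_of_termDiffs (fun d hd h => (hF d hd).2 h)
      (Set.mem_singleton (boolPart f, boolPart g)) h1
  exact ⟨(dom_boolPart_iff hN).1 h2.1, (dom_boolPart_iff hN).1 h2.2⟩

end TotalCone

/-- A real subspace contains vectors that form part of a dual basis of integer vectors. -/
theorem exists_dual_vectors (k : ℕ) : ∀ W : Submodule ℝ (Fin n → ℝ), k ≤ Module.finrank ℝ W →
    ∃ (m : ℕ → Fin n → ℤ) (v : ℕ → Fin n → ℝ), (∀ i, v i ∈ W) ∧
      ∀ i < k, ∀ j < k, pairing (m j) (v i) = if i = j then 1 else 0 := by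
  induction k with
  | zero => exact fun W _ => ⟨0, 0, fun _ => W.zero_mem, by simp⟩
  | succ k ih =>
    intro W hW
    have hne : W ≠ ⊥ := by
      rintro rfl
      simp at hW
    -- The new integer vector is a coordinate functional that is nonzero on W; the induction
    -- continues on its kernel in W.
    obtain ⟨u, hu, hu0⟩ := W.ne_bot_iff.1 hne
    obtain ⟨i₀, hi₀⟩ := Function.ne_iff.1 hu0
    rw [Pi.zero_apply] at hi₀
    let p : W →ₗ[ℝ] ℝ := (LinearMap.proj i₀ : (Fin n → ℝ) →ₗ[ℝ] ℝ) ∘ₗ W.subtype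
    have hker : k ≤ Module.finrank ℝ ((LinearMap.ker p).map W.subtype) := by
      rw [Submodule.finrank_map_subtype_eq]
      have h1 := p.finrank_range_add_finrank_ker
      have h2 : Module.finrank ℝ (LinearMap.range p) ≤ 1 := by
        simpa using Submodule.finrank_le (LinearMap.range p)
      omega
    obtain ⟨m, v, hv, hmv⟩ := ih _ hker
    have hv' : ∀ i, v i ∈ W ∧ v i i₀ = 0 := fun i => by
      obtain ⟨w, hw, hwv⟩ := hv i
      rw [← hwv]
      exact ⟨w.2, hw⟩
    let u' : Fin n → ℝ := (u i₀)⁻¹ • u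
    let u'' : Fin n → ℝ := u' - ∑ j ∈ Finset.range k, pairing (m j) u' • v j
    refine ⟨Function.update m k (Pi.single i₀ 1), Function.update v k u'', fun i => ?_, ?_⟩
    · rcases eq_or_ne i k with hi | hi
      · rw [hi, Function.update_self]
        exact W.sub_mem (W.smul_mem _ hu)
          (W.sum_mem fun j _ => W.smul_mem _ (hv' j).1)
      · rw [Function.update_of_ne hi]
        exact (hv' i).1
    · intro i hi j hj
      rcases eq_or_ne i k with hik | hik <;> rcases eq_or_ne j k with hjk | hjk
      · rw [hik, hjk, Function.update_self, Function.update_self, pairing_single, if_pos rfl]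
        simp [u'', u', (hv' _).2, hi₀]
      · rw [hik, Function.update_self, Function.update_of_ne hjk, if_neg (Ne.symm hjk)]
        have hj' : j < k := by omega
        simp only [u'', map_sub, map_sum, map_smul, smul_eq_mul]
        rw [Finset.sum_eq_single j, hmv j hj' j hj', if_pos rfl, mul_one, map_smul, smul_eq_mul,
          sub_self]
        · intro l hl hlj
          rw [hmv l (Finset.mem_range.1 hl) j hj', if_neg hlj, mul_zero]
        · intro h
          exact absurd (Finset.mem_range.2 hj') h
      · rw [hjk, Function.update_self, Function.update_of_ne hik, pairing_single, if_neg hik,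
          (hv' i).2]
      · rw [Function.update_of_ne hik, Function.update_of_ne hjk]
        exact hmv i (by omega) j (by omega)

-- The comparison at x is followed by those along v 0, …, v (k − 1). The flag starts at the trivial
-- preorder, which accounts for the extra step.
open TotalCone in
theorem exists_flag_of_containsBall {k : ℕ} {C : RingCon (Laurent n)}
    (h : ContainsBall k (congVariety (pairs C))) :
    ∃ N : ℕ → TotalCone n, (∀ i < k + 1, N (i + 1) < N i) ∧ C ≤ (N (k + 1)).cong := by
  obtain ⟨x, W, hk, ε, hε, hball⟩ := h
  obtain ⟨m, v, hv, hmv⟩ := exists_dual_vectors k W hk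
  let M : ℕ → TotalCone n := fun i => Nat.casesOn i (pointCone x) fun i => dirCone (v i)
  refine ⟨flag M, fun i hi => ?_, le_cong_of_approximable
    (approximable_flag (fun _ _ => Iff.rfl) (fun _ => rfl) hv k) hε hball⟩
  rcases i with _ | i
  · refine flag_succ_lt (a := (-1, 0)) (by simp) ?_
    change ¬ 0 ≤ termVal x (-1, 0)
    simp [termVal]
  -- The real coefficient is chosen to make the term vanish at x.
  · refine flag_succ_lt (a := (pairing (m i) x, -m i)) (fun j hj => ?_) ?_
    · rcases j with _ | j
      · change 0 ≤ termVal x _ ∧ 0 ≤ termVal x (-_)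
        simp [termVal_eq, pairing_neg]
      · change 0 ≤ pairing (-m i) (v j) ∧ 0 ≤ pairing (-(-m i)) (v j)
        rw [neg_neg, pairing_neg, hmv j (by omega) i (by omega), if_neg (by omega)]
        simp
    · change ¬ 0 ≤ pairing (-m i) (v i)
      rw [pairing_neg, hmv i (by omega) i (by omega), if_pos rfl]
      norm_num

open TotalCone in
theorem exists_flag_of_containsBall_boolCong {k : ℕ} {C : RingCon (Laurent n)}
    (h : ContainsBall k (congVariety (pairs (boolCong C)))) :
    ∃ N : ℕ → TotalCone n, (∀ i < k, N (i + 1) < N i) ∧ C ≤ (N k).cong := by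
  obtain ⟨x, W, hk, ε, hε, hball⟩ := h
  obtain ⟨m, v, hv, hmv⟩ := exists_dual_vectors k W hk
  obtain ⟨D, hD⟩ := exists_nat_gt ((∑ j ∈ Finset.range k, ‖v j‖) / ε)
  have hD0 : (0 : ℝ) < D := lt_of_le_of_lt (by positivity) hD
  -- The point is moved inside the ball so that its pairings with the m j become p j / D. They are
  -- nonzero, so that the moved point is a nontrivial direction, and rational, so that integer
  -- combinations of two m j vanish on it. D is large enough to keep the move below ε.
  have hp : ∀ j, ∃ p : ℤ, p ≠ 0 ∧ |p - D * pairing (m j) x| ≤ 1 := by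
    intro j
    by_cases h : ⌊D * pairing (m j) x⌋ = 0
    · refine ⟨1, one_ne_zero, ?_⟩
      rw [Int.floor_eq_zero_iff] at h
      rw [abs_le]
      constructor <;> push_cast <;> linarith [h.1, h.2]
    · refine ⟨_, h, ?_⟩
      rw [abs_le]
      constructor <;> linarith [Int.floor_le (D * pairing (m j) x),
        Int.lt_floor_add_one (D * pairing (m j) x)]
  choose p hp0 hp using hp
  let w : Fin n → ℝ := ∑ j ∈ Finset.range k, (p j / D - pairing (m j) x) • v j
  have hw : w ∈ W := W.sum_mem fun j _ => W.smul_mem _ (hv j)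
  have hwε : ‖w‖ < ε := by
    calc ‖w‖ ≤ ∑ j ∈ Finset.range k, 1 / D * ‖v j‖ := by
          refine norm_sum_le_of_le _ fun j _ => ?_
          rw [norm_smul]
          refine mul_le_mul_of_nonneg_right ?_ (norm_nonneg _)
          rw [Real.norm_eq_abs, le_div_iff₀ hD0, ← abs_of_pos hD0, ← abs_mul, abs_of_pos hD0,
            sub_mul, div_mul_cancel₀ _ hD0.ne', mul_comm _ (D : ℝ)]
          exact hp j
      _ < ε := by
          rw [← Finset.mul_sum, one_div, inv_mul_lt_iff₀ hD0]
          rwa [div_lt_iff₀ hε] at hD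
  have hpx : ∀ j < k, pairing (m j) (x + w) = p j / D := by
    intro j hj
    simp only [w, map_add, map_sum, map_smul, smul_eq_mul]
    rw [Finset.sum_eq_single j, hmv j hj j hj, if_pos rfl]
    · ring
    · intro l hl hlj
      rw [hmv l (Finset.mem_range.1 hl) j hj, if_neg hlj, mul_zero]
    · intro h
      exact absurd (Finset.mem_range.2 hj) h
  -- The moved point takes the place of v 0, so the first k comparisons use v 1, …, v (k − 1).
  let M : ℕ → TotalCone n :=
    fun i => Nat.casesOn i (dirCone (x + w)) fun i => dirCone (v (i + 1))
  have hreal : ∀ i, ((-1, 0) : Term n) ∈ flag M i := fun i => mem_flag fun j _ => by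
    rcases j with _ | j <;> exact (pairing_zero_left _).ge
  -- `approximable_flag` concerns flags of positive length; using length k + 1 and then enlarging
  -- the cone also covers k = 0.
  refine ⟨flag M, fun i hi => ?_, (le_cong_of_approximable_boolCong (hreal (k + 1))
    (approximable_flag (x := x + w) (W := W) (fun d hd => ?_) (fun _ => rfl)
      (fun i => hv (i + 1)) k) (sub_pos.2 hwε) fun u hu huε => ?_).trans
      (cong_mono (refine_le _ _))⟩
  · have hp2 : ∀ j, 0 < (p j : ℝ) * p j := fun j =>
      mul_self_pos.2 (by exact_mod_cast hp0 j)
    rcases i with _ | i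
    · refine flag_succ_lt (a := (0, (-p 0) • m 0)) (by simp) ?_
      change ¬ 0 ≤ pairing ((-p 0) • m 0) (x + w)
      rw [pairing_zsmul, hpx 0 hi, not_le, Int.cast_neg, neg_mul, ← mul_div_assoc, neg_lt_zero]
      exact div_pos (hp2 0) hD0
    · have hval : ∀ u, pairing (p 0 • (p (i + 1) • m 0 + -(p 0 • m (i + 1)))) u =
          p 0 * (p (i + 1) * pairing (m 0) u - p 0 * pairing (m (i + 1)) u) := fun u => by
        rw [pairing_zsmul, pairing_add, pairing_neg, pairing_zsmul, pairing_zsmul, sub_eq_add_neg]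
      -- This exponent pairs to 0 with the moved point and with the earlier v j. The outer factor p
      -- 0 makes its pairing with v (i + 1) equal to −(p 0)², which is negative.
      refine flag_succ_lt (a := (0, p 0 • (p (i + 1) • m 0 + -(p 0 • m (i + 1)))))
        (fun j hj => ?_) ?_
      · suffices ∃ u, M j = dirCone u ∧
            pairing (p 0 • (p (i + 1) • m 0 + -(p 0 • m (i + 1)))) u = 0 by
          obtain ⟨u, hu, hu0⟩ := this
          rw [hu, mem_dirCone, mem_dirCone, Prod.snd_neg, pairing_neg, hu0]
          simp
        rcases j with _ | j
        · refine ⟨x + w, rfl, ?_⟩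
          rw [hval, hpx 0 (by omega), hpx (i + 1) hi]
          ring
        · refine ⟨v (j + 1), rfl, ?_⟩
          rw [hval, hmv (j + 1) (by omega) 0 (by omega), hmv (j + 1) (by omega) (i + 1) hi,
            if_neg (by omega), if_neg (by omega)]
          ring
      · change ¬ 0 ≤ pairing _ (v (i + 1))
        rw [hval, hmv (i + 1) hi 0 (by omega), hmv (i + 1) hi (i + 1) hi, if_neg (by omega),
          if_pos rfl, not_le]
        linarith [hp2 0]
  · rw [termVal_eq, show d.1 = 0 from hd, zero_add]
    exact Iff.rfl
  · rw [add_assoc]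
    refine hball _ (W.add_mem hw hu) ?_
    calc ‖w + u‖ ≤ ‖w‖ + ‖u‖ := norm_add_le _ _
      _ < ε := by linarith

/-! ### Prime congruences of a quotient -/

/-- The image in the quotient by `C` of a congruence above `C`. -/
def quotientCong {A : Type*} [CommSemiring A] {C E : RingCon A} (h : C ≤ E) :
    RingCon C.Quotient where
  r x y := ∃ a b : A, (a : C.Quotient) = x ∧ (b : C.Quotient) = y ∧ E a b
  iseqv :=
    { refl := fun x => by
        obtain ⟨a, rfl⟩ := C.mk'_surjective x
        exact ⟨a, a, rfl, rfl, E.refl a⟩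
      symm := fun ⟨a, b, ha, hb, hab⟩ => ⟨b, a, hb, ha, E.symm hab⟩
      trans := by
        rintro x y z ⟨a, b, rfl, rfl, hab⟩ ⟨c, d, hc, rfl, hcd⟩
        exact ⟨a, d, rfl, rfl, E.trans hab (E.trans (E.symm (h (C.eq.1 hc))) hcd)⟩ }
  add' := by
    rintro _ _ _ _ ⟨a, b, rfl, rfl, hab⟩ ⟨c, d, rfl, rfl, hcd⟩
    exact ⟨a + c, b + d, rfl, rfl, E.add hab hcd⟩
  mul' := by
    rintro _ _ _ _ ⟨a, b, rfl, rfl, hab⟩ ⟨c, d, rfl, rfl, hcd⟩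
    exact ⟨a * c, b * d, rfl, rfl, E.mul hab hcd⟩

theorem quotientCong_iff {A : Type*} [CommSemiring A] {C E : RingCon A} (h : C ≤ E) {a b : A} :
    quotientCong h (a : C.Quotient) b ↔ E a b := by
  constructor
  · rintro ⟨c, d, hc, hd, hcd⟩
    exact E.trans (E.symm (h (C.eq.1 hc))) (E.trans hcd (h (C.eq.1 hd)))
  · exact fun hab => ⟨a, b, rfl, rfl, hab⟩

theorem isPrimeCong_comap_iff {A : Type*} [CommSemiring A] {C : RingCon A}
    {E : RingCon C.Quotient} : IsPrimeCong (E.comap C.mk') ↔ IsPrimeCong E := by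
  refine and_congr (not_congr ⟨fun h => ?_, fun h => ?_⟩) ⟨fun h => ?_, fun h a b c d => ?_⟩
  · refine top_unique fun x y _ => ?_
    obtain ⟨a, rfl⟩ := C.mk'_surjective x
    obtain ⟨b, rfl⟩ := C.mk'_surjective y
    have : E.comap C.mk' a b := by rw [h]; trivial
    exact this
  · rw [h]
    rfl
  · intro a b c d
    obtain ⟨a, rfl⟩ := C.mk'_surjective a
    obtain ⟨b, rfl⟩ := C.mk'_surjective b
    obtain ⟨c, rfl⟩ := C.mk'_surjective c
    obtain ⟨d, rfl⟩ := C.mk'_surjective d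
    exact h a b c d
  · exact h a b c d

/-- The prime congruences of the quotient by `C` correspond to the total cones whose congruence
contains `C`. -/
theorem congKrullDim_quotient (C : RingCon (Laurent n)) :
    congKrullDim C.Quotient = Order.krullDim {N : TotalCone n // C ≤ N.cong} := by
  have hprime : ∀ E : {E : RingCon C.Quotient // IsPrimeCong E},
      IsPrimeCong (E.1.comap C.mk') := fun E => isPrimeCong_comap_iff.2 E.2
  have hle : ∀ E : RingCon C.Quotient, C ≤ E.comap C.mk' := fun E a b hab => by
    have : (a : C.Quotient) = b := C.eq.2 hab
    change E (a : C.Quotient) b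
    rw [this]
    exact E.refl _
  let φ : {E : RingCon C.Quotient // IsPrimeCong E} ↪o {N : TotalCone n // C ≤ N.cong} :=
    OrderEmbedding.ofMapLEIff
      (fun E => ⟨(hprime E).cone, by rw [IsPrimeCong.cong_cone]; exact hle E.1⟩) (by
        intro E E'
        rw [Subtype.mk_le_mk, ← TotalCone.cong_le_cong_iff, IsPrimeCong.cong_cone,
          IsPrimeCong.cong_cone]
        constructor
        · intro h x y hxy
          obtain ⟨a, rfl⟩ := C.mk'_surjective x
          obtain ⟨b, rfl⟩ := C.mk'_surjective y
          exact h (x := a) (y := b) hxy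
        · intro h a b hab
          exact h hab)
  refine Order.krullDim_eq_of_orderIso (RelIso.ofSurjective φ fun N => ?_)
  have hcomap : (quotientCong N.2).comap C.mk' = N.1.cong :=
    RingCon.ext fun a b => quotientCong_iff N.2
  have hE : IsPrimeCong (quotientCong N.2) := by
    rw [← isPrimeCong_comap_iff, hcomap]
    exact N.1.isPrimeCong_cong
  refine ⟨⟨_, hE⟩, Subtype.ext ?_⟩
  have h1 := (IsPrimeCong.cong_cone (hprime ⟨_, hE⟩)).trans hcomap
  exact le_antisymm (TotalCone.le_of_cong_le h1.le) (TotalCone.le_of_cong_le h1.ge)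

theorem le_congKrullDim_of_flag {C : RingCon (Laurent n)} {k : ℕ} {N : ℕ → TotalCone n}
    (hN : ∀ i < k, N (i + 1) < N i) (hC : C ≤ (N k).cong) :
    (k : WithBot ℕ∞) ≤ congKrullDim C.Quotient := by
  rw [congKrullDim_quotient]
  have hanti : ∀ i ≤ k, C ≤ (N i).cong := by
    intro i hi
    induction hi using Nat.decreasingInduction with
    | self => exact hC
    | of_succ i hi ih => exact ih.trans (TotalCone.cong_mono (hN i hi).le)
  let p : LTSeries {N : TotalCone n // C ≤ N.cong} :=
    { length := k
      toFun := fun i => ⟨N (k - i), hanti _ (Nat.sub_le _ _)⟩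
      step := fun i => by
        have := hN (k - (i + 1)) (by omega)
        rw [show k - (i + 1) + 1 = k - i by omega] at this
        exact this }
  exact Order.LTSeries.length_le_krullDim p

/-- The dimension formula; it also holds for the improper congruence, where both sides are `⊥`. -/
theorem exists_dim_and_congKrullDim_eq {C : RingCon (Laurent n)}
    (hfin : HasFiniteTropicalBasis C) (hfinB : HasFiniteTropicalBasis (boolCong C)) :
    ∃ d e : WithBot ℕ∞, HasPolyhedralDim (congVariety (pairs C)) d ∧
      HasPolyhedralDim (congVariety (pairs (boolCong C))) e ∧
      congKrullDim C.Quotient = max (d + 1) e := by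
  obtain ⟨K, hK⟩ := exists_complex hfin
  obtain ⟨K', hK'⟩ := exists_complex hfinB
  refine ⟨K.dim, K'.dim, hasPolyhedralDim_dim hK, hasPolyhedralDim_dim hK',
    le_antisymm ?_ (max_le ?_ ?_)⟩
  · rw [congKrullDim_quotient]
    refine iSup_le fun p => ?_
    have h1 : p.head.1.corank + p.length ≤ p.last.1.corank :=
      (LTSeries.map p (fun N => N.1.corank) fun _ _ h =>
        TotalCone.corank_lt h).head_add_length_le_nat
    have h3 := h1.trans p.last.1.corank_le
    -- The coranks along the chain are strictly increasing numbers up to n + 1, so the length is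
    -- bounded by n + 1 minus the corank of the smallest cone. Whether that cone identifies
    -- constants decides which variety is large.
    by_cases hN : ((-1, 0) : Term n) ∈ p.head.1
    · rw [TotalCone.corank, if_pos hN] at h3
      have h4 := TotalCone.containsBall_congVariety_boolCong hN p.head.2 hfinB
      rw [← hK'] at h4
      refine le_max_of_le_right (le_trans ?_ (K'.le_dim_of_containsBall h4))
      exact_mod_cast (by omega :
        p.length ≤ n - Module.finrank ℤ p.head.1.dir)
    · rw [TotalCone.corank, if_neg hN] at h3
      have h4 := TotalCone.containsBall_congVariety hN p.head.2 hfin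
      rw [← hK] at h4
      have h5 : Module.finrank ℤ p.head.1.dir ≤ n := by
        simpa using Submodule.finrank_le p.head.1.dir
      refine le_max_of_le_left (le_trans ?_ (add_le_add_left (K.le_dim_of_containsBall h4) 1))
      exact_mod_cast (by omega :
        p.length ≤ n - Module.finrank ℤ p.head.1.dir + 1)
  · rcases K.dim_eq_bot_or with h | ⟨k, hk, hball⟩
    · rw [h]
      exact bot_le
    · rw [hK] at hball
      obtain ⟨N, hN, hCN⟩ := exists_flag_of_containsBall hball
      rw [hk]
      exact_mod_cast le_congKrullDim_of_flag hN hCN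
  · rcases K'.dim_eq_bot_or with h | ⟨k, hk, hball⟩
    · rw [h]
      exact bot_le
    · rw [hK'] at hball
      obtain ⟨N, hN, hCN⟩ := exists_flag_of_containsBall_boolCong hball
      rw [hk]
      exact le_congKrullDim_of_flag hN hCN

end TropKrull

end

theorem theorem3p3 (n : ℕ) (C : RingCon (TropKrull.Laurent n)) (hC : C ≠ ⊤)
    (hfin : TropKrull.HasFiniteTropicalBasis C)
    (hfinB : TropKrull.HasFiniteTropicalBasis (TropKrull.boolCong C)) :
    ∃ d e : WithBot ℕ∞,
      TropKrull.HasPolyhedralDim (TropKrull.congVariety (TropKrull.pairs C)) d ∧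
      TropKrull.HasPolyhedralDim
        (TropKrull.congVariety (TropKrull.pairs (TropKrull.boolCong C))) e ∧
      TropKrull.congKrullDim C.Quotient = max (d + 1) e :=
  TropKrull.exists_dim_and_congKrullDim_eq hfin hfinB
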